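/- A \emph{Type-2-Machine} over a finite output alphabet $\Gamma \ni 0$ is a finite directed graph with one read-only input tape and two working tapes over $\{0,1\}$ and one write-only output tape over $\Gamma$, all one-way infinite. Its vertices are labelled by instructions: start (exactly one vertex, a source); test the scanned symbol of the input tape or of a working tape (two successors); move the head of one of these tapes left (undefined on the first cell) or right; write a symbol on a working tape or on the output tape and move that head right; accept; reject. Initially the input tape contains $x\in\{0,1\}^{\mathbb N}$, all other tapes contain $0^{\mathbb N}$, and all heads are on the first cell. The computation yields $w\in\Gamma^{\mathbb N}$ if either an accepting vertex is reached with $w$ on the output tape, or the head of the output tape passes through all positions and the contents of the output tape converge to $w$. An \emph{Oracle-Type-2-Machine} (with $\Gamma=\{0,1\}$) may also have vertices labelled $?$ with two successors. At such a vertex, a copy of the machine, with erased output tape, its head on the first cell, is started in the second successor; if it yields $u$ and $v$ is an answer of the oracle to $u$, then the machine continues in the first successor with $v$ written on the second working tape and that tape's head on the first cell. With query depth $0$ no such transition is possible, and with query depth $n+1$ the copy works with query depth $n$. The machine \emph{makes a single oracle call} if, on every input, a vertex labelled $?$ occurs at most once during any run (including the computation of the query). A \emph{finitely revising machine} is a Type-2-Machine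 without oracle and with output alphabet $\{0,1,\#\}$, where $\#$ is a revising mark that revokes everything printed before it. It maps $x\in\{0,1\}^{\mathbb N}$ to $y\in\{0,1\}^{\mathbb N}$ if, on input $x$, it yields a sequence $z\in\{0,1,\#\}^{\mathbb N}$ that contains only finitely many $\#$ and whose part after the last $\#$ (all of $z$ if there is none) is $y$. Let $MAX:\subseteq\mathbb N^{\mathbb N}\to\mathbb N$ be the partial function defined on the bounded sequences by $MAX(w)=\max\{w(i)\mid i\in\mathbb N\}$. As an oracle it takes $w$ encoded as $1^{w(0)}0\,1^{w(1)}0\,1^{w(2)}0\cdots$ and returns the answer $n$ encoded as $1^n0^{\mathbb N}$; it has no answer on other queries. \textbf{Theorem.} For every finitely revising machine $R$ there is an Oracle-Type-2-Machine $M$ that makes a single oracle call to $MAX$ and computes the same partial function as $R$ (with the same domain): for every query depth $n\ge 1$ and all $x,y\in\{0,1\}^{\mathbb N}$, $M$ yields $y$ on input $x$ with oracle $MAX$ and query depth $n$ if and only if $R$ maps $x$ to $y$. -/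

import Mathlib

open Filter

namespace TypeTwo

/-- The tapes that a machine can read: the input tape and two working tapes. -/
inductive TapeId
  | input
  | work (i : Fin 2)
  deriving DecidableEq

/-- The label of a vertex together with its successors. `Γ` is the alphabet of the
(one-way, write-only) output tape, `V` is the set of vertices. -/
inductive Instr (Γ V : Type)
  /-- label `s` -/
  | start (next : V)
  /-- label `t`: branch on the scanned symbol (first successor for `0`, second for `1`) -/
  | test (t : TapeId) (next₀ next₁ : V)
  /-- label `l`: move a head to the left -/
  | left (t : TapeId) (next : V)
  /-- label `r`: move a head to the right -/
  | right (t : TapeId) (next : V)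
  /-- write on a working tape and move its head to the right -/
  | write (i : Fin 2) (b : Bool) (next : V)
  /-- write on the output tape and move its head to the right -/
  | print (g : Γ) (next : V)
  /-- label `?`: the first successor continues with the oracle answer, the second one
  is where the computation of the query starts -/
  | query (next₀ next₁ : V)
  /-- label `a` -/
  | accept
  /-- label `r` of a sink -/
  | reject

/-- `q` is a successor of a vertex with the given label. -/
def Instr.HasSucc {Γ V : Type} : Instr Γ V → V → Prop
  | .start p, q => q = p
  | .test _ p₀ p₁, q => q = p₀ ∨ q = p₁
  | .left _ p, q => q = p
  | .right _ p, q => q = p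
  | .write _ _ p, q => q = p
  | .print _ p, q => q = p
  | .query p₀ p₁, q => q = p₀ ∨ q = p₁
  | .accept, _ => False
  | .reject, _ => False

/-- An Oracle-Type-2-Machine: a finite labelled directed graph with exactly one vertex
labelled `s`, which is a source. -/
structure Machine (Γ : Type) where
  V : Type
  finite : Finite V
  instr : V → Instr Γ V
  source : V
  start_iff : ∀ q, (∃ p, instr q = .start p) ↔ q = source
  no_edge_to_source : ∀ q, ¬ (instr q).HasSucc source

/-- A configuration: current vertex, contents and head positions of the input tape and of
the working tapes, content and head position of the output tape. -/
structure Cfg (Γ V : Type) where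
  state : V
  tape : TapeId → ℕ → Bool
  head : TapeId → ℕ
  out : ℕ → Γ
  outHead : ℕ

namespace Machine

variable {Γ : Type}

/-- A Type-2-Machine proper: there is no vertex labelled `?`. -/
def IsPlain (M : Machine Γ) : Prop :=
  ∀ q p₀ p₁, M.instr q ≠ .query p₀ p₁

/-- The current vertex is labelled `?`. -/
def AtQuery (M : Machine Γ) (c : Cfg Γ M.V) : Prop :=
  ∃ p₀ p₁, M.instr c.state = .query p₀ p₁

/-- The single step of a machine without oracle. There is no successor configuration at the
sinks, at a vertex labelled `?`, and when a head would have to leave its tape to the left. -/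
def next (M : Machine Γ) (c : Cfg Γ M.V) : Option (Cfg Γ M.V) :=
  match M.instr c.state with
  | .start p => some { c with state := p }
  | .test t p₀ p₁ => some { c with state := if c.tape t (c.head t) then p₁ else p₀ }
  | .left t p =>
      if c.head t = 0 then none
      else some { c with state := p, head := Function.update c.head t (c.head t - 1) }
  | .right t p => some { c with state := p, head := Function.update c.head t (c.head t + 1) }
  | .write i b p =>
      some { c with
        state := p
        tape := Function.update c.tape (.work i)
          (Function.update (c.tape (.work i)) (c.head (.work i)) b)
        head := Function.update c.head (.work i) (c.head (.work i) + 1) }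
  | .print g p =>
      some { c with
        state := p
        out := Function.update c.out c.outHead g
        outHead := c.outHead + 1 }
  | .query _ _ => none
  | .accept => none
  | .reject => none

/-- The configuration `c` yields the output `w`, relative to a relation `R` of (multi-step)
transitions: either an accepting configuration with output tape `w` is reached, or the head
of the output tape runs through all positions and the output tapes converge to `w`. -/
def Yields (M : Machine Γ) (R : Cfg Γ M.V → Cfg Γ M.V → Prop) (c : Cfg Γ M.V)
    (w : ℕ → Γ) : Prop :=
  (∃ d, R c d ∧ M.instr d.state = .accept ∧ d.out = w) ∨
  (∃ d : ℕ → Cfg Γ M.V, (∀ m, c.outHead ≤ m → R c (d m) ∧ (d m).outHead = m) ∧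
    ∀ i, ∀ᶠ m in atTop, (d m).out i = w i)

variable [Inhabited Γ]

/-- The configuration in which the computation of an oracle query starts: a copy of `c` at
the vertex `p` with erased output tape (`default` is the blank symbol `0`). -/
def spawn (M : Machine Γ) (c : Cfg Γ M.V) (p : M.V) : Cfg Γ M.V :=
  { c with state := p, out := fun _ => default, outHead := 0 }

/-- The initial configuration on input `x`. -/
def init (M : Machine Γ) (x : ℕ → Bool) : Cfg Γ M.V where
  state := M.source
  tape
    | .input => x
    | .work _ => fun _ => false
  head := fun _ => 0
  out := fun _ => default
  outHead := 0

/-- The single-step transition relation with oracle `O` and query depth `n`. The oracle is a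
multi-valued partial function; its answer is written on the second working tape. -/
def Step (M : Machine Γ) (O : (ℕ → Γ) → Set (ℕ → Bool)) :
    ℕ → Cfg Γ M.V → Cfg Γ M.V → Prop
  | 0 => fun c d => M.next c = some d
  | n + 1 => fun c d =>
      Step M O n c d ∨
      ∃ p₀ p₁ x y, M.instr c.state = .query p₀ p₁ ∧
        M.Yields (Relation.ReflTransGen (Step M O n)) (M.spawn c p₁) x ∧ y ∈ O x ∧
        d = { c with
          state := p₀
          tape := Function.update c.tape (.work 1) y
          head := Function.update c.head (.work 1) 0 }

/-- The relation of arbitrary transitions with oracle `O` and query depth `n`. -/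
def Reaches (M : Machine Γ) (O : (ℕ → Γ) → Set (ℕ → Bool)) (n : ℕ) :
    Cfg Γ M.V → Cfg Γ M.V → Prop :=
  Relation.ReflTransGen (M.Step O n)

/-- The multi-valued function computed with oracle `O` and query depth `n`. -/
def result (M : Machine Γ) (O : (ℕ → Γ) → Set (ℕ → Bool)) (n : ℕ) (x : ℕ → Bool) :
    Set (ℕ → Γ) :=
  {y | M.Yields (M.Reaches O n) (M.init x) y}

/-- During any run a vertex labelled `?` occurs at most once; the computation of the query
belongs to the run. -/
def AtMostOneQuery (M : Machine Γ) (O : (ℕ → Γ) → Set (ℕ → Bool)) : Prop :=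
  ∀ n x c p₀ p₁, M.Reaches O n (M.init x) c → M.instr c.state = .query p₀ p₁ →
    (∀ d, M.Reaches O n (M.spawn c p₁) d → ¬ M.AtQuery d) ∧
    (∀ d e, M.Step O n c d → M.Reaches O n d e → ¬ M.AtQuery e)

end Machine

/-- `F` is computed by an Oracle-Type-2-Machine that makes a single call to the oracle `O`
(so that the functions computed with query depth `n` are stable from `n = 1` on). -/
def SingleQueryComputable (O : (ℕ → Bool) → Set (ℕ → Bool))
    (F : (ℕ → Bool) → Set (ℕ → Bool)) : Prop :=
  ∃ M : Machine Bool, M.AtMostOneQuery O ∧ ∀ n, 1 ≤ n → ∀ x, M.result O n x = F x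

/-- The output alphabet of a revising machine: the symbols `0`, `1` and a revising mark. -/
inductive RevSym
  | bit (b : Bool)
  | mark

/-- The blank symbol is `0`. -/
instance : Inhabited RevSym := ⟨.bit false⟩

/-- `z` contains only finitely many revising marks, and `y` is the part of `z` after the last
one (all of `z` if there is none). -/
def RevisesTo (z : ℕ → RevSym) (y : ℕ → Bool) : Prop :=
  ∃ N, (∀ k, N = k + 1 → z k = .mark) ∧ ∀ i, z (N + i) = .bit (y i)

/-- `F` is computed by a finitely revising machine: a Type-2-Machine (without oracle) that may
print revising marks, each of which revokes everything that was printed before. -/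
def FinitelyRevisingComputable (F : (ℕ → Bool) → Set (ℕ → Bool)) : Prop :=
  ∃ M : Machine RevSym, M.IsPlain ∧
    ∀ x, F x = {y | ∃ z ∈ M.result (fun _ => ∅) 0 x, RevisesTo z y}

/-- `p` is the sequence `1^{w(0)} 0 1^{w(1)} 0 1^{w(2)} 0 ⋯`. -/
def EncodesSeq (p : ℕ → Bool) (w : ℕ → ℕ) : Prop :=
  ∀ j, p j = false ↔ ∃ k, j + 1 = ∑ i ∈ Finset.range (k + 1), (w i + 1)

/-- The partial function `MAX` that maps a bounded sequence of natural numbers to its maximum,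
as an oracle on binary sequences (no answer where `MAX` is undefined); the answer `n` is encoded as `1^n 0 0 0 ⋯`. -/
def maxOracle (p : ℕ → Bool) : Set (ℕ → Bool) :=
  {y | ∃ (w : ℕ → ℕ) (n : ℕ), EncodesSeq p w ∧ IsGreatest (Set.range w) n ∧
    y = fun i => decide (i < n)}

end TypeTwo

namespace TypeTwo

/-! The machine `M` simulates `R` twice: once inside the query and once after the answer. In the
query it computes the sequence `width z`, where `z` is the output of `R`: a bit at position `k`
contributes the value 0, a mark contributes the number of marks printed up to and including it. The
maximum of this sequence is the total number `n` of marks, provided that it is finite. With `n` in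
unary on the second working tape, `M` runs `R` again, skips everything before the `n`-th mark and
prints the bits after it. It rejects if a further mark appears or if `R` accepts before the `n`-th
mark.

If `R` maps `x` to `y`, then the query is the encoding of `width z` (`runYields_queryPhase`), the
oracle answers `n` (`mem_maxOracle`), and the second run yields `y` (`runYields_answerPhase`).
Conversely, `exists_runYields_of_answerPhase` shows for every `n`, correct answer or not, that
whatever the second run yields is the part after the last mark of an output of `R`; this gives
equality of the domains.

Both working tapes of `R` are kept on the first working tape of `M` (`encTape`), so that the second
one is free for the counter and for the answer; `reachPlus_simCfg` simulates single steps.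
`Code.mem_result` reduces the oracle semantics to two oracle-free deterministic runs. It needs a
single-valued oracle, which is `subsingleton_maxOracle`. -/

/-- The single step of a machine, as a function of its labelled graph alone. -/
def stepOf {Γ V : Type} (instr : V → Instr Γ V) (c : Cfg Γ V) : Option (Cfg Γ V) :=
  match instr c.state with
  | .start p => some { c with state := p }
  | .test t p₀ p₁ => some { c with state := if c.tape t (c.head t) then p₁ else p₀ }
  | .left t p =>
      if c.head t = 0 then none
      else some { c with state := p, head := Function.update c.head t (c.head t - 1) }
  | .right t p => some { c with state := p, head := Function.update c.head t (c.head t + 1) }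
  | .write i b p =>
      some { c with
        state := p
        tape := Function.update c.tape (.work i)
          (Function.update (c.tape (.work i)) (c.head (.work i)) b)
        head := Function.update c.head (.work i) (c.head (.work i) + 1) }
  | .print g p =>
      some { c with
        state := p
        out := Function.update c.out c.outHead g
        outHead := c.outHead + 1 }
  | .query _ _ => none
  | .accept => none
  | .reject => none

theorem next_eq_stepOf {Γ : Type} (M : Machine Γ) (c : Cfg Γ M.V) :
    M.next c = stepOf M.instr c := by
  unfold Machine.next stepOf
  cases M.instr c.state <;> rfl

/-- Reachability without oracle calls. -/
def Reach {Γ V : Type} (instr : V → Instr Γ V) : Cfg Γ V → Cfg Γ V → Prop :=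
  Relation.ReflTransGen (fun c d => stepOf instr c = some d)

/-- Reachability without oracle calls in at least one step. -/
def ReachPlus {Γ V : Type} (instr : V → Instr Γ V) : Cfg Γ V → Cfg Γ V → Prop :=
  Relation.TransGen (fun c d => stepOf instr c = some d)

/-- The configuration `c` yields `w` without oracle calls. -/
def RunYields {Γ V : Type} (instr : V → Instr Γ V) (c : Cfg Γ V) (w : ℕ → Γ) : Prop :=
  (∃ d, Reach instr c d ∧ instr d.state = .accept ∧ d.out = w) ∨
  (∃ d : ℕ → Cfg Γ V, (∀ m, c.outHead ≤ m → Reach instr c (d m) ∧ (d m).outHead = m) ∧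
    ∀ i, ∀ᶠ m in atTop, (d m).out i = w i)

/-! ### Deterministic runs without oracle -/

section Runs

variable {Γ V : Type} {instr : V → Instr Γ V}

theorem ReachPlus.toReach {c d : Cfg Γ V} (h : ReachPlus instr c d) : Reach instr c d :=
  Relation.TransGen.to_reflTransGen h

theorem Reach.trans {c d e : Cfg Γ V} (h : Reach instr c d) (h' : Reach instr d e) :
    Reach instr c e :=
  Relation.ReflTransGen.trans h h'

theorem Reach.head {c d e : Cfg Γ V} (h : stepOf instr c = some d) (h' : Reach instr d e) :
    Reach instr c e :=
  Relation.ReflTransGen.head h h'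

theorem ReachPlus.head {c d e : Cfg Γ V} (h : stepOf instr c = some d) (h' : Reach instr d e) :
    ReachPlus instr c e :=
  Relation.TransGen.head' h h'

theorem Reach.total {c d e : Cfg Γ V} (h : Reach instr c d) (h' : Reach instr c e) :
    Reach instr d e ∨ Reach instr e d :=
  Relation.ReflTransGen.total_of_right_unique
    (fun _ _ _ h₁ h₂ => Option.some.inj (h₁.symm.trans h₂)) h h'

theorem Reach.eq_of_stuck {c d : Cfg Γ V} (h : Reach instr c d) (hc : stepOf instr c = none) :
    d = c := by
  rcases Relation.ReflTransGen.cases_head h with h | ⟨e, he, -⟩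
  · exact h.symm
  · rw [hc] at he; cases he

theorem stepOf_accept {c : Cfg Γ V} (h : instr c.state = .accept) : stepOf instr c = none := by
  simp [stepOf, h]

theorem stepOf_out {c d : Cfg Γ V} (h : stepOf instr c = some d) :
    (d.outHead = c.outHead ∧ d.out = c.out) ∨
      ∃ g, d.outHead = c.outHead + 1 ∧ d.out = Function.update c.out c.outHead g := by
  unfold stepOf at h
  split at h
  case h_6 g p _ =>
    obtain rfl := Option.some.inj h
    exact Or.inr ⟨g, rfl, rfl⟩
  case h_3 =>
    split_ifs at h
    obtain rfl := Option.some.inj h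
    exact Or.inl ⟨rfl, rfl⟩
  all_goals first
    | (cases h; done)
    | (obtain rfl := Option.some.inj h; exact Or.inl ⟨rfl, rfl⟩)

theorem Reach.outHead_le {c d : Cfg Γ V} (h : Reach instr c d) : c.outHead ≤ d.outHead := by
  induction h with
  | refl => exact le_rfl
  | tail _ h ih => rcases stepOf_out h with h | ⟨g, h, -⟩ <;> omega

theorem Reach.out_eq {c d : Cfg Γ V} (h : Reach instr c d) {i : ℕ} (hi : i < c.outHead) :
    d.out i = c.out i := by
  induction h with
  | refl => rfl
  | tail h₁ h ih =>
    have := Reach.outHead_le h₁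
    rcases stepOf_out h with h | ⟨g, -, h⟩
    · rw [h.2, ih]
    · rw [h, Function.update_of_ne (by omega), ih]

theorem Reach.out_eq_of_ge {c d : Cfg Γ V} (h : Reach instr c d) {i : ℕ} (hi : d.outHead ≤ i) :
    d.out i = c.out i := by
  induction h with
  | refl => rfl
  | tail h₁ h ih =>
    rcases stepOf_out h with h | ⟨g, h', h⟩
    · rw [h.2, ih (h.1 ▸ hi)]
    · rw [h, Function.update_of_ne (by omega), ih (by omega)]

theorem Reach.exists_outHead_eq {c d : Cfg Γ V} (h : Reach instr c d) {m : ℕ}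
    (h₁ : c.outHead ≤ m) (h₂ : m ≤ d.outHead) :
    ∃ e, Reach instr c e ∧ Reach instr e d ∧ e.outHead = m := by
  induction h with
  | refl => exact ⟨c, .refl, .refl, by omega⟩
  | @tail a b hca h ih =>
    by_cases hm : m ≤ a.outHead
    · obtain ⟨e, he, he', rfl⟩ := ih hm
      exact ⟨e, he, he'.tail h, rfl⟩
    · refine ⟨b, hca.tail h, .refl, ?_⟩
      rcases stepOf_out h with h | ⟨g, h, -⟩ <;> omega

/-- Printed cells never change and the output head advances by single cells. So every run with a
long output passes through each smaller head position with the correct prefix already written. -/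
theorem runYields_of_unbounded {c : Cfg Γ V} {w : ℕ → Γ}
    (h : ∀ k, ∃ d, Reach instr c d ∧ k ≤ d.outHead ∧ ∀ i < d.outHead, d.out i = w i) :
    RunYields instr c w := by
  right
  have key : ∀ m, c.outHead ≤ m →
      ∃ e, (Reach instr c e ∧ e.outHead = m) ∧ ∀ i < m, e.out i = w i := by
    intro m hm
    obtain ⟨d, hd, hk, hw⟩ := h m
    obtain ⟨e, he, he', rfl⟩ := hd.exists_outHead_eq hm hk
    exact ⟨e, ⟨he, rfl⟩, fun i hi => by rw [← hw i (by omega), he'.out_eq hi]⟩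
  have : Nonempty (Cfg Γ V) := ⟨c⟩
  choose! e he hw using key
  refine ⟨e, he, fun i => ?_⟩
  filter_upwards [eventually_ge_atTop c.outHead, eventually_gt_atTop i] with m hm hi
  exact hw m hm i hi

/-- A configuration that yields `w` either accepts with `w` on the output tape or writes
arbitrarily long prefixes of `w`. -/
theorem RunYields.cases {c : Cfg Γ V} {w : ℕ → Γ} (h : RunYields instr c w) :
    (∃ d, Reach instr c d ∧ instr d.state = .accept ∧ d.out = w) ∨
      ((∀ k, ∃ d, Reach instr c d ∧ k ≤ d.outHead) ∧
        ∀ d, Reach instr c d → ∀ i, c.outHead ≤ i → i < d.outHead → d.out i = w i) := by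
  rcases h with h | ⟨d, hd, hw⟩
  · exact Or.inl h
  · refine Or.inr ⟨fun k => ?_, fun e he i _ hi => ?_⟩
    · exact ⟨d (max c.outHead k), (hd _ (le_max_left _ _)).1,
        (hd _ (le_max_left _ _)).2.symm ▸ le_max_right _ _⟩
    · obtain ⟨m, hm, hm₁, hm₂⟩ := ((hw i).and ((eventually_ge_atTop c.outHead).and
        (eventually_gt_atTop e.outHead))).exists
      rw [← hm]
      rcases he.total (hd m hm₁).1 with h | h
      · exact (h.out_eq hi).symm
      · have := h.outHead_le
        have := (hd m hm₁).2
        omega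

theorem RunYields.out_eq {c : Cfg Γ V} {w : ℕ → Γ} (h : RunYields instr c w)
    (hc : c.outHead = 0) {d : Cfg Γ V} (hd : Reach instr c d) {i : ℕ} (hi : i < d.outHead) :
    d.out i = w i := by
  rcases h.cases with ⟨e, he, hacc, rfl⟩ | ⟨-, h⟩
  · rcases hd.total he with h | h
    · exact (h.out_eq hi).symm
    · rw [h.eq_of_stuck (stepOf_accept hacc)]
  · exact h d hd i (by omega) hi

theorem RunYields.unique {c : Cfg Γ V} {w w' : ℕ → Γ} (h : RunYields instr c w)
    (h' : RunYields instr c w') (hc : c.outHead = 0) : w = w' := by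
  have aux : ∀ {w w' : ℕ → Γ}, RunYields instr c w' →
      (∃ d, Reach instr c d ∧ instr d.state = .accept ∧ d.out = w) → w = w' := by
    rintro w w' h' ⟨d, hd, hacc, rfl⟩
    rcases h'.cases with ⟨e, he, hacc', rfl⟩ | ⟨hk, -⟩
    · rcases hd.total he with h | h
      · rw [h.eq_of_stuck (stepOf_accept hacc)]
      · rw [h.eq_of_stuck (stepOf_accept hacc')]
    -- An accepting configuration has no successor, so the output head cannot get beyond its
    -- position there; this excludes the second kind of yielding.
    · obtain ⟨e, he, hke⟩ := hk (d.outHead + 1)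
      rcases hd.total he with h | h
      · rw [h.eq_of_stuck (stepOf_accept hacc)] at hke; omega
      · have := h.outHead_le; omega
  rcases h.cases with h₁ | ⟨hk, hw⟩
  · exact aux h' h₁
  · rcases h'.cases with h₂ | ⟨-, hw'⟩
    · exact (aux h h₂).symm
    · funext i
      obtain ⟨d, hd, hi⟩ := hk (i + 1)
      rw [← hw d hd i (by omega) hi, ← hw' d hd i (by omega) hi]

/-- A preliminary phase that prints nothing can be cut off. This disposes of the setup of the
simulation. -/
theorem Reach.runYields_iff {c c' : Cfg Γ V} (h : Reach instr c c') (hc : c.outHead = 0)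
    (hc' : c'.outHead = 0) (w : ℕ → Γ) : RunYields instr c w ↔ RunYields instr c' w := by
  constructor
  · intro hw
    rcases hw.cases with ⟨d, hd, hacc, rfl⟩ | ⟨hk, -⟩
    · refine Or.inl ⟨d, ?_, hacc, rfl⟩
      rcases h.total hd with H | H
      · exact H
      · rw [H.eq_of_stuck (stepOf_accept hacc)]
        exact .refl
    · refine runYields_of_unbounded fun k => ?_
      obtain ⟨d, hd, hkd⟩ := hk (k + 1)
      rcases h.total hd with H | H
      · exact ⟨d, H, by omega, fun i hi => hw.out_eq hc hd hi⟩
      · have := H.outHead_le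
        omega
  · rintro (⟨d, hd, hacc, rfl⟩ | ⟨d, hd, hw⟩)
    · exact Or.inl ⟨d, h.trans hd, hacc, rfl⟩
    · exact Or.inr ⟨d, fun m _ => ⟨h.trans (hd m (by omega)).1, (hd m (by omega)).2⟩, hw⟩

end Runs

/-! ### Invariance of runs under renaming of vertices -/

section Map

variable {Γ V W : Type}

/-- Rename the vertices in an instruction. -/
def Instr.map (f : V → W) : Instr Γ V → Instr Γ W
  | .start p => .start (f p)
  | .test t p q => .test t (f p) (f q)
  | .left t p => .left t (f p)
  | .right t p => .right t (f p)
  | .write i b p => .write i b (f p)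
  | .print g p => .print g (f p)
  | .query p q => .query (f p) (f q)
  | .accept => .accept
  | .reject => .reject

/-- Rename the vertices in a configuration. -/
def Cfg.map (f : V → W) (c : Cfg Γ V) : Cfg Γ W where
  state := f c.state
  tape := c.tape
  head := c.head
  out := c.out
  outHead := c.outHead

variable {instr : V → Instr Γ V} {instr' : W → Instr Γ W} {f : V → W}

theorem stepOf_map (hf : ∀ v, instr' (f v) = (instr v).map f) (c : Cfg Γ V) :
    stepOf instr' (c.map f) = (stepOf instr c).map (Cfg.map f) := by
  unfold stepOf
  have : instr' (c.map f).state = (instr c.state).map f := hf _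
  rw [this]
  cases instr c.state with
  | test t p q => by_cases h : c.tape t (c.head t) = true <;> simp [Instr.map, Cfg.map, h]
  | left t p =>
    by_cases h : c.head t = 0 <;> simp [Instr.map, Cfg.map, h]
  | _ => rfl

theorem Reach.map (hf : ∀ v, instr' (f v) = (instr v).map f) {c d : Cfg Γ V}
    (h : Reach instr c d) : Reach instr' (c.map f) (d.map f) := by
  induction h with
  | refl => exact .refl
  | tail _ h ih => exact ih.tail (by rw [stepOf_map hf, h]; rfl)

theorem Reach.exists_of_map (hf : ∀ v, instr' (f v) = (instr v).map f) {c : Cfg Γ V}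
    {e : Cfg Γ W} (h : Reach instr' (c.map f) e) : ∃ d, Reach instr c d ∧ d.map f = e := by
  induction h with
  | refl => exact ⟨c, .refl, rfl⟩
  | tail _ h ih =>
    obtain ⟨d, hd, rfl⟩ := ih
    rw [stepOf_map hf] at h
    obtain ⟨d', hd', rfl⟩ := Option.map_eq_some_iff.1 h
    exact ⟨d', hd.tail hd', rfl⟩

theorem map_eq_accept {I : Instr Γ V} : I.map f = .accept ↔ I = .accept := by
  cases I <;> simp [Instr.map]

theorem runYields_map (hf : ∀ v, instr' (f v) = (instr v).map f) (c : Cfg Γ V) (w : ℕ → Γ) :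
    RunYields instr' (c.map f) w ↔ RunYields instr c w := by
  have hacc : ∀ d : Cfg Γ V, instr' (d.map f).state = .accept ↔ instr d.state = .accept :=
    fun d => by rw [show instr' (d.map f).state = _ from hf _, map_eq_accept]
  constructor
  · rintro (⟨e, he, hacc', rfl⟩ | ⟨e, he, hw⟩)
    · obtain ⟨d, hd, rfl⟩ := he.exists_of_map hf
      exact Or.inl ⟨d, hd, (hacc d).1 hacc', rfl⟩
    · have hex := fun m hm => (he m hm).1.exists_of_map hf
      have : Nonempty (Cfg Γ V) := ⟨c⟩
      choose! d hd hde using hex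
      refine Or.inr ⟨d, fun m hm => ⟨hd m hm, (congrArg Cfg.outHead (hde m hm)).trans (he m hm).2⟩,
        fun i => ?_⟩
      filter_upwards [hw i, eventually_ge_atTop c.outHead] with m h₁ hm
      rw [← h₁, ← hde m hm]; rfl
  · rintro (⟨d, hd, h, rfl⟩ | ⟨d, hd, hw⟩)
    · exact Or.inl ⟨_, hd.map hf, (hacc d).2 h, rfl⟩
    · exact Or.inr ⟨fun m => (d m).map f,
        fun m hm => ⟨(hd m hm).1.map hf, (hd m hm).2⟩, hw⟩

end Map

theorem Machine.step_zero {Γ : Type} [Inhabited Γ] (M : Machine Γ) (O : (ℕ → Γ) → Set (ℕ → Bool))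
    (c d : Cfg Γ M.V) : M.Step O 0 c d ↔ stepOf M.instr c = some d := by
  rw [← next_eq_stepOf]
  rfl

theorem Machine.step_succ {Γ : Type} [Inhabited Γ] (M : Machine Γ) (O : (ℕ → Γ) → Set (ℕ → Bool))
    (n : ℕ) (c d : Cfg Γ M.V) : M.Step O (n + 1) c d ↔ M.Step O n c d ∨
      ∃ p₀ p₁ x y, M.instr c.state = .query p₀ p₁ ∧
        M.Yields (Relation.ReflTransGen (M.Step O n)) (M.spawn c p₁) x ∧ y ∈ O x ∧
        d = { c with
          state := p₀
          tape := Function.update c.tape (.work 1) y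
          head := Function.update c.head (.work 1) 0 } :=
  Iff.rfl

/-! ### Programs, and the machine that asks one query -/

/-- A loop-free program for a machine with output alphabet `{0,1}` whose branches end by jumping
to a label from `L`, by accepting or by rejecting. -/
inductive Code (L : Type)
  | goto (l : L)
  | test (t : TapeId) (k₀ k₁ : Code L)
  | left (t : TapeId) (k : Code L)
  | right (t : TapeId) (k : Code L)
  | write (i : Fin 2) (b : Bool) (k : Code L)
  | print (b : Bool) (k : Code L)
  | accept
  | reject

namespace Code

variable {L : Type}

/-- The first instruction of a program; `prog l` is the program at the label `l`. -/
def instr (prog : L → Code L) : Code L → Instr Bool (Code L)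
  -- A test with equal successors serves as an unconditional jump.
  | goto l => .test .input (prog l) (prog l)
  | test t k₀ k₁ => .test t k₀ k₁
  | left t k => .left t k
  | right t k => .right t k
  | write i b k => .write i b k
  | print b k => .print b k
  | accept => .accept
  | reject => .reject

/-- The set of subprograms. -/
def subs : Code L → Set (Code L)
  | goto l => {goto l}
  | test t k₀ k₁ => insert (test t k₀ k₁) (subs k₀ ∪ subs k₁)
  | left t k => insert (left t k) (subs k)
  | right t k => insert (right t k) (subs k)
  | write i b k => insert (write i b k) (subs k)
  | print b k => insert (print b k) (subs k)
  | accept => {accept}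
  | reject => {reject}

theorem mem_subs_self (k : Code L) : k ∈ subs k := by
  cases k <;> simp [subs]

theorem subs_subset {k K : Code L} (h : k ∈ subs K) : subs k ⊆ subs K := by
  induction K with
  | goto | accept | reject =>
    rw [subs, Set.mem_singleton_iff] at h
    rw [h]
  | test t k₀ k₁ ih₀ ih₁ =>
    rw [subs] at h
    rcases h with rfl | h | h
    · rfl
    · exact (ih₀ h).trans fun a ha => Or.inr (Or.inl ha)
    · exact (ih₁ h).trans fun a ha => Or.inr (Or.inr ha)
  | left t k ih | right t k ih | write _ _ k ih | print _ k ih =>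
    rw [subs] at h
    rcases h with rfl | h
    · rfl
    · exact (ih h).trans fun a ha => Or.inr ha

theorem finite_subs (k : Code L) : (subs k).Finite := by
  induction k with
  | goto | accept | reject => exact Set.finite_singleton _
  | test t k₀ k₁ ih₀ ih₁ => exact (ih₀.union ih₁).insert _
  | left t k ih | right t k ih | write _ _ k ih | print _ k ih => exact ih.insert _

/-- The subprograms of the programs `prog l`. -/
def Sub (prog : L → Code L) : Type := {k : Code L // ∃ l, k ∈ subs (prog l)}

variable {prog : L → Code L}

theorem finite_sub [Finite L] (prog : L → Code L) : Finite (Sub prog) := by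
  have : Set.Finite (⋃ l, subs (prog l)) := Set.finite_iUnion fun l => finite_subs (prog l)
  have h : {k | ∃ l, k ∈ subs (prog l)} ⊆ ⋃ l, subs (prog l) := by
    rintro k ⟨l, h⟩
    exact Set.mem_iUnion.2 ⟨l, h⟩
  exact (this.subset h).to_subtype

/-- The program at a label. -/
def Sub.at (prog : L → Code L) (l : L) : Sub prog := ⟨prog l, l, mem_subs_self _⟩

theorem exists_mem_subs {k k' : Code L} (h : ∃ l, k ∈ subs (prog l)) (h' : k' ∈ subs k) :
    ∃ l, k' ∈ subs (prog l) :=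
  h.imp fun _ h => subs_subset h h'

/-- The first instruction of a program, as an instruction on subprograms. -/
def Sub.instr : Sub prog → Instr Bool (Sub prog)
  | ⟨goto l, _⟩ => .test .input (Sub.at prog l) (Sub.at prog l)
  | ⟨test t k₀ k₁, h⟩ => .test t
      ⟨k₀, exists_mem_subs h (Or.inr (Or.inl (mem_subs_self k₀)))⟩
      ⟨k₁, exists_mem_subs h (Or.inr (Or.inr (mem_subs_self k₁)))⟩
  | ⟨left t k, h⟩ => .left t ⟨k, exists_mem_subs h (Or.inr (mem_subs_self k))⟩
  | ⟨right t k, h⟩ => .right t ⟨k, exists_mem_subs h (Or.inr (mem_subs_self k))⟩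
  | ⟨write i b k, h⟩ => .write i b ⟨k, exists_mem_subs h (Or.inr (mem_subs_self k))⟩
  | ⟨print b k, h⟩ => .print b ⟨k, exists_mem_subs h (Or.inr (mem_subs_self k))⟩
  | ⟨accept, _⟩ => .accept
  | ⟨reject, _⟩ => .reject

/-- Finiteness of the graph requires the vertex set `Sub prog`, but runs are easier to follow on all
of `Code L`; this is the compatibility needed to pass between them. -/
theorem instr_val (s : Sub prog) : Code.instr prog s.1 = (Sub.instr s).map Subtype.val := by
  rcases s with ⟨k, h⟩
  cases k <;> rfl

/-- The labelled graph of `singleQueryMachine`. Its vertices are the source (`inl false`), the only vertex labelled `?`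
(`inl true`), and the subprograms. -/
def queryInstr (prog : L → Code L) (l₀ l₁ : L) :
    Bool ⊕ Sub prog → Instr Bool (Bool ⊕ Sub prog)
  | .inl false => .start (.inl true)
  | .inl true => .query (.inr (Sub.at prog l₀)) (.inr (Sub.at prog l₁))
  | .inr s => (Sub.instr s).map .inr

theorem subInstr_inr_ne_start (s : Sub prog) (p : Bool ⊕ Sub prog) :
    (Sub.instr s).map Sum.inr ≠ .start p := by
  rcases s with ⟨k, h⟩
  cases k <;> simp [Sub.instr, Instr.map]

theorem subInstr_inr_ne_query (s : Sub prog) (p q : Bool ⊕ Sub prog) :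
    (Sub.instr s).map Sum.inr ≠ .query p q := by
  rcases s with ⟨k, h⟩
  cases k <;> simp [Sub.instr, Instr.map]

/-- The machine that first queries the oracle with the output of the program at `l₁` and then runs
the program at `l₀` on the answer. -/
def singleQueryMachine [Finite L] (prog : L → Code L) (l₀ l₁ : L) : Machine Bool where
  V := Bool ⊕ Sub prog
  finite := by
    have := finite_sub prog
    infer_instance
  instr := queryInstr prog l₀ l₁
  source := .inl false
  start_iff := by
    rintro ((_ | _) | s)
    · simp [queryInstr]
    · simp [queryInstr]
    · simp [queryInstr, subInstr_inr_ne_start]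
  no_edge_to_source := by
    rintro ((_ | _) | ⟨k, h⟩)
    · simp [queryInstr, Instr.HasSucc]
    · simp [queryInstr, Instr.HasSucc]
    · cases k <;> simp [queryInstr, Sub.instr, Instr.map, Instr.HasSucc]

end Code

/-- The configuration with given vertex, content of and position on the input tape, the two
working tapes and the output tape. -/
def conf {Γ V : Type} (q : V) (X : ℕ → Bool) (x : ℕ) (A : ℕ → Bool) (a : ℕ) (B : ℕ → Bool)
    (b : ℕ) (o : ℕ → Γ) (h : ℕ) : Cfg Γ V where
  state := q
  tape
    | .input => X
    | .work 0 => A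
    | .work 1 => B
  head
    | .input => x
    | .work 0 => a
    | .work 1 => b
  out := o
  outHead := h

/-! ### Semantics of the single-query machine -/

namespace Code

variable {L : Type} (prog : L → Code L) (l₀ l₁ : L)
  {O : (ℕ → Bool) → Set (ℕ → Bool)}

theorem runYields_queryInstr (s : Sub prog) (X A B : ℕ → Bool) (x a b h : ℕ) (o w : ℕ → Bool) :
    RunYields (queryInstr prog l₀ l₁) (conf (.inr s) X x A a B b o h) w ↔
      RunYields (Code.instr prog) (conf s.1 X x A a B b o h) w := by
  have h₁ := runYields_map (instr := Sub.instr) (instr' := queryInstr prog l₀ l₁) (f := Sum.inr)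
    (fun _ => rfl) (conf s X x A a B b o h) w
  have h₂ := runYields_map (instr := Sub.instr) (instr' := Code.instr prog) (f := Subtype.val)
    instr_val (conf s X x A a B b o h) w
  exact h₁.trans h₂.symm

theorem state_inr_of_stepOf {c d : Cfg Bool (Bool ⊕ Sub prog)} {s : Sub prog}
    (hs : c.state = .inr s) (h : stepOf (queryInstr prog l₀ l₁) c = some d) :
    ∃ s', d.state = .inr s' := by
  have hc : c = Cfg.map Sum.inr
      { state := s, tape := c.tape, head := c.head, out := c.out, outHead := c.outHead } := by
    cases c; cases hs; rfl
  rw [hc, stepOf_map (instr := Sub.instr) (f := Sum.inr) (fun _ => rfl)] at h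
  obtain ⟨e, -, rfl⟩ := Option.map_eq_some_iff.1 h
  exact ⟨_, rfl⟩

variable [Finite L]

/-- The subprograms contain no vertex labelled `?`, so the oracle and the query depth do not matter
once a subprogram is entered. -/
theorem step_of_inr {n : ℕ} {c d : Cfg Bool (singleQueryMachine prog l₀ l₁).V} {s : Sub prog}
    (hs : c.state = .inr s) :
    (singleQueryMachine prog l₀ l₁).Step O n c d ↔ stepOf (queryInstr prog l₀ l₁) c = some d := by
  induction n with
  | zero =>
    rw [Machine.step_zero]
    rfl
  | succ n ih =>
    rw [Machine.step_succ, ih, or_iff_left]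
    rintro ⟨p₀, p₁, -, -, h, -⟩
    rw [hs] at h
    exact subInstr_inr_ne_query s p₀ p₁ h

theorem reaches_of_inr {n : ℕ} {c d : Cfg Bool (singleQueryMachine prog l₀ l₁).V} {s : Sub prog}
    (hs : c.state = .inr s) :
    (singleQueryMachine prog l₀ l₁).Reaches O n c d ↔ Reach (queryInstr prog l₀ l₁) c d := by
  constructor
  · intro h
    suffices Reach (queryInstr prog l₀ l₁) c d ∧ ∃ s', d.state = .inr s' from this.1
    induction h with
    | refl => exact ⟨.refl, s, hs⟩
    | tail _ h ih =>
      obtain ⟨hr, s', hs'⟩ := ih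
      have h' := (step_of_inr prog l₀ l₁ hs').1 h
      exact ⟨hr.tail h', state_inr_of_stepOf prog l₀ l₁ hs' h'⟩
  · intro h
    suffices (singleQueryMachine prog l₀ l₁).Reaches O n c d ∧ ∃ s', d.state = .inr s' from this.1
    induction h with
    | refl => exact ⟨.refl, s, hs⟩
    | tail _ h ih =>
      obtain ⟨hr, s', hs'⟩ := ih
      exact ⟨hr.tail ((step_of_inr prog l₀ l₁ hs').2 h), state_inr_of_stepOf prog l₀ l₁ hs' h⟩

theorem not_atQuery_of_reaches {n : ℕ} {c d : Cfg Bool (singleQueryMachine prog l₀ l₁).V}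
    {s : Sub prog} (hs : c.state = .inr s)
    (h : (singleQueryMachine prog l₀ l₁).Reaches O n c d) :
    ¬ (singleQueryMachine prog l₀ l₁).AtQuery d := by
  have : ∃ s', d.state = .inr s' := by
    rw [reaches_of_inr prog l₀ l₁ hs] at h
    induction h with
    | refl => exact ⟨s, hs⟩
    | tail _ h ih => exact state_inr_of_stepOf prog l₀ l₁ ih.choose_spec h
  obtain ⟨s', hs'⟩ := this
  rintro ⟨p₀, p₁, h⟩
  rw [hs'] at h
  exact subInstr_inr_ne_query s' p₀ p₁ h

theorem yields_of_inr {n : ℕ} {c : Cfg Bool (singleQueryMachine prog l₀ l₁).V} {s : Sub prog}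
    (hs : c.state = .inr s) (w : ℕ → Bool) :
    (singleQueryMachine prog l₀ l₁).Yields
      ((singleQueryMachine prog l₀ l₁).Reaches O n) c w ↔
      RunYields (queryInstr prog l₀ l₁) c w := by
  unfold Machine.Yields RunYields
  simp only [reaches_of_inr prog l₀ l₁ hs]
  rfl

/-- The configuration at the query. -/
def queryCfg (x : ℕ → Bool) : Cfg Bool (singleQueryMachine prog l₀ l₁).V :=
  { (singleQueryMachine prog l₀ l₁).init x with state := .inl true }

theorem step_init {n : ℕ} {x : ℕ → Bool} {d : Cfg Bool (singleQueryMachine prog l₀ l₁).V} :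
    (singleQueryMachine prog l₀ l₁).Step O n ((singleQueryMachine prog l₀ l₁).init x) d ↔
      d = queryCfg prog l₀ l₁ x := by
  induction n with
  | zero =>
    rw [Machine.step_zero]
    exact Option.some_inj.trans eq_comm
  | succ n ih =>
    rw [Machine.step_succ, ih, or_iff_left]
    rintro ⟨p₀, p₁, -, -, h, -⟩
    cases h

/-- The configuration after the answer `v`. -/
def answerCfg (x v : ℕ → Bool) : Cfg Bool (singleQueryMachine prog l₀ l₁).V :=
  conf (.inr (Sub.at prog l₀)) x 0 (fun _ => false) 0 v 0 (fun _ => false) 0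

theorem step_queryCfg_zero {x : ℕ → Bool} {d : Cfg Bool (singleQueryMachine prog l₀ l₁).V} :
    ¬ (singleQueryMachine prog l₀ l₁).Step O 0 (queryCfg prog l₀ l₁ x) d := by
  rw [Machine.step_zero]
  exact fun h => Option.some_ne_none d h.symm

theorem spawn_queryCfg (x : ℕ → Bool) (s : Sub prog) :
    (singleQueryMachine prog l₀ l₁).spawn (queryCfg prog l₀ l₁ x) (.inr s) =
      conf (.inr s) x 0 (fun _ => false) 0 (fun _ => false) 0 (fun _ => false) 0 := by
  unfold Machine.spawn conf queryCfg Machine.init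
  congr 1 <;>
  · funext t
    rcases t with _ | i
    · rfl
    · fin_cases i <;> rfl

theorem answer_queryCfg (x v : ℕ → Bool) :
    ({ queryCfg prog l₀ l₁ x with
        state := .inr (Sub.at prog l₀)
        tape := Function.update (queryCfg prog l₀ l₁ x).tape (.work 1) v
        head := Function.update (queryCfg prog l₀ l₁ x).head (.work 1) 0 } :
      Cfg Bool (singleQueryMachine prog l₀ l₁).V) = answerCfg prog l₀ l₁ x v := by
  unfold answerCfg conf queryCfg Machine.init
  dsimp only
  congr 1 <;>
  · funext t
    rcases t with _ | i
    · rfl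
    · fin_cases i <;> rfl

/-- The condition does not depend on the depth: the computation of the query makes no further query,
so all disjuncts in the recursion for `Step` coincide. -/
theorem step_queryCfg {n : ℕ} {x : ℕ → Bool} {d : Cfg Bool (singleQueryMachine prog l₀ l₁).V} :
    (singleQueryMachine prog l₀ l₁).Step O (n + 1) (queryCfg prog l₀ l₁ x) d ↔
      ∃ p v, RunYields (Code.instr prog) (conf (prog l₁) x 0 (fun _ => false) 0 (fun _ => false) 0
        (fun _ => false) 0) p ∧ v ∈ O p ∧ d = answerCfg prog l₀ l₁ x v := by
  have key : ∀ n, (∃ p₀ p₁ p v,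
      (singleQueryMachine prog l₀ l₁).instr (queryCfg prog l₀ l₁ x).state = .query p₀ p₁ ∧
      (singleQueryMachine prog l₀ l₁).Yields
        (Relation.ReflTransGen ((singleQueryMachine prog l₀ l₁).Step O n))
        ((singleQueryMachine prog l₀ l₁).spawn (queryCfg prog l₀ l₁ x) p₁) p ∧ v ∈ O p ∧
      d = { queryCfg prog l₀ l₁ x with
          state := p₀
          tape := Function.update (queryCfg prog l₀ l₁ x).tape (.work 1) v
          head := Function.update (queryCfg prog l₀ l₁ x).head (.work 1) 0 }) ↔
      ∃ p v, RunYields (Code.instr prog) (conf (prog l₁) x 0 (fun _ => false) 0 (fun _ => false) 0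
        (fun _ => false) 0) p ∧ v ∈ O p ∧ d = answerCfg prog l₀ l₁ x v := by
    intro n
    have hy : ∀ p, (singleQueryMachine prog l₀ l₁).Yields
        (Relation.ReflTransGen ((singleQueryMachine prog l₀ l₁).Step O n))
        ((singleQueryMachine prog l₀ l₁).spawn (queryCfg prog l₀ l₁ x)
          (.inr (Sub.at prog l₁))) p ↔
        RunYields (Code.instr prog) (conf (prog l₁) x 0 (fun _ => false) 0 (fun _ => false) 0
          (fun _ => false) 0) p := by
      intro p
      rw [spawn_queryCfg]
      exact (yields_of_inr prog l₀ l₁ rfl p).trans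
        (runYields_queryInstr prog l₀ l₁ (Sub.at prog l₁) _ _ _ _ _ _ _ _ _)
    constructor
    · rintro ⟨p₀, p₁, p, v, h, h₁, h₂, rfl⟩
      cases h
      exact ⟨p, v, (hy p).1 h₁, h₂, answer_queryCfg prog l₀ l₁ x v⟩
    · rintro ⟨p, v, h₁, h₂, rfl⟩
      exact ⟨_, _, p, v, rfl, (hy p).2 h₁, h₂, (answer_queryCfg prog l₀ l₁ x v).symm⟩
  induction n with
  | zero => rw [Machine.step_succ, or_iff_right (step_queryCfg_zero prog l₀ l₁), key]
  | succ n ih =>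
    rw [Machine.step_succ]
    exact (or_congr ih (key _)).trans or_self_iff

theorem reaches_init {n : ℕ} {x : ℕ → Bool} {d : Cfg Bool (singleQueryMachine prog l₀ l₁).V} :
    (singleQueryMachine prog l₀ l₁).Reaches O n ((singleQueryMachine prog l₀ l₁).init x) d ↔
      d = (singleQueryMachine prog l₀ l₁).init x ∨ d = queryCfg prog l₀ l₁ x ∨
      ∃ e, (singleQueryMachine prog l₀ l₁).Step O n (queryCfg prog l₀ l₁ x) e ∧
        (singleQueryMachine prog l₀ l₁).Reaches O n e d := by
  unfold Machine.Reaches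
  rw [Relation.ReflTransGen.cases_head_iff, eq_comm]
  simp only [step_init, exists_eq_left]
  rw [Relation.ReflTransGen.cases_head_iff (a := queryCfg prog l₀ l₁ x), eq_comm (b := d)]

theorem exists_answerCfg {n : ℕ} {x : ℕ → Bool} {e : Cfg Bool (singleQueryMachine prog l₀ l₁).V}
    (h : (singleQueryMachine prog l₀ l₁).Step O n (queryCfg prog l₀ l₁ x) e) :
    ∃ v, e = answerCfg prog l₀ l₁ x v := by
  cases n with
  | zero => exact absurd h (step_queryCfg_zero prog l₀ l₁)
  | succ n =>
    obtain ⟨-, v, -, -, h⟩ := (step_queryCfg prog l₀ l₁).1 h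
    exact ⟨v, h⟩

theorem atMostOneQuery : (singleQueryMachine prog l₀ l₁).AtMostOneQuery O := by
  intro n x c p₀ p₁ hc hq
  rcases (reaches_init prog l₀ l₁).1 hc with rfl | rfl | ⟨e, he, hr⟩
  · cases hq
  · cases hq
    refine ⟨fun d hd => ?_, fun d e hd he => ?_⟩
    · rw [spawn_queryCfg] at hd
      exact not_atQuery_of_reaches prog l₀ l₁ rfl hd
    · obtain ⟨v, rfl⟩ := exists_answerCfg prog l₀ l₁ hd
      exact not_atQuery_of_reaches prog l₀ l₁ rfl he
  · obtain ⟨v, rfl⟩ := exists_answerCfg prog l₀ l₁ he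
    exact absurd ⟨p₀, p₁, hq⟩ (not_atQuery_of_reaches prog l₀ l₁ rfl hr)

theorem mem_result (hO : ∀ p, (O p).Subsingleton) (n : ℕ) (x y : ℕ → Bool) :
    y ∈ (singleQueryMachine prog l₀ l₁).result O (n + 1) x ↔
      ∃ p v, RunYields (Code.instr prog) (conf (prog l₁) x 0 (fun _ => false) 0 (fun _ => false) 0
        (fun _ => false) 0) p ∧ v ∈ O p ∧
        RunYields (Code.instr prog)
          (conf (prog l₀) x 0 (fun _ => false) 0 v 0 (fun _ => false) 0) y := by
  have hy : ∀ v, RunYields (Code.instr prog)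
      (conf (prog l₀) x 0 (fun _ => false) 0 v 0 (fun _ => false) 0) y ↔
      (singleQueryMachine prog l₀ l₁).Yields
        ((singleQueryMachine prog l₀ l₁).Reaches O (n + 1)) (answerCfg prog l₀ l₁ x v) y :=
    fun v => ((yields_of_inr prog l₀ l₁ rfl y).trans
      (runYields_queryInstr prog l₀ l₁ (Sub.at prog l₀) _ _ _ _ _ _ _ _ _)).symm
  simp only [hy]
  constructor
  · intro h
    -- The query has at most one output and the oracle at most one answer on it, so the
    -- configuration after the query is unique.
    have huniq : ∀ e e', (singleQueryMachine prog l₀ l₁).Step O (n + 1) (queryCfg prog l₀ l₁ x) e →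
        (singleQueryMachine prog l₀ l₁).Step O (n + 1) (queryCfg prog l₀ l₁ x) e' → e = e' := by
      intro e e' he he'
      obtain ⟨p, v, h₁, h₂, rfl⟩ := (step_queryCfg prog l₀ l₁).1 he
      obtain ⟨p', v', h₁', h₂', rfl⟩ := (step_queryCfg prog l₀ l₁).1 he'
      obtain rfl := h₁.unique h₁' rfl
      rw [hO p h₂ h₂']
    rcases h with ⟨d, hd, hacc, rfl⟩ | ⟨d, hd, hw⟩
    · rcases (reaches_init prog l₀ l₁).1 hd with rfl | rfl | ⟨e, he, hr⟩
      · cases hacc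
      · cases hacc
      · obtain ⟨p, v, h₁, h₂, rfl⟩ := (step_queryCfg prog l₀ l₁).1 he
        exact ⟨p, v, h₁, h₂, Or.inl ⟨d, hr, hacc, rfl⟩⟩
    · have hd' : ∀ m, 1 ≤ m → ∃ e,
          (singleQueryMachine prog l₀ l₁).Step O (n + 1) (queryCfg prog l₀ l₁ x) e ∧
          (singleQueryMachine prog l₀ l₁).Reaches O (n + 1) e (d m) := by
        intro m hm
        obtain ⟨h₁, h₂⟩ := hd m (Nat.zero_le _)
        rcases (reaches_init prog l₀ l₁).1 h₁ with h | h | h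
        · rw [h] at h₂
          exact absurd (show 0 = m from h₂) (by omega)
        · rw [h] at h₂
          exact absurd (show 0 = m from h₂) (by omega)
        · exact h
      obtain ⟨e, he, -⟩ := hd' 1 le_rfl
      obtain ⟨p, v, h₁, h₂, rfl⟩ := (step_queryCfg prog l₀ l₁).1 he
      -- `d 0` may precede the answer and is replaced; the limit is unaffected.
      refine ⟨p, v, h₁, h₂, Or.inr ⟨fun m => if m = 0 then answerCfg prog l₀ l₁ x v else d m,
        fun m _ => ?_, fun i => ?_⟩⟩
      · by_cases hm : m = 0
        · subst hm
          exact ⟨.refl, rfl⟩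
        · obtain ⟨e', he', hr⟩ := hd' m (by omega)
          rw [huniq _ _ he' he] at hr
          simp only [if_neg hm]
          exact ⟨hr, (hd m (Nat.zero_le _)).2⟩
      · filter_upwards [hw i, eventually_gt_atTop 0] with m h hm
        rw [if_neg hm.ne', h]
  · rintro ⟨p, v, h₁, h₂, h⟩
    have hr : ∀ d, (singleQueryMachine prog l₀ l₁).Reaches O (n + 1)
        (answerCfg prog l₀ l₁ x v) d →
        (singleQueryMachine prog l₀ l₁).Reaches O (n + 1)
          ((singleQueryMachine prog l₀ l₁).init x) d := fun d hd =>
      (reaches_init prog l₀ l₁).2 (Or.inr (Or.inr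
        ⟨_, (step_queryCfg prog l₀ l₁).2 ⟨p, v, h₁, h₂, rfl⟩, hd⟩))
    rcases h with ⟨d, hd, hacc, rfl⟩ | ⟨d, hd, hw⟩
    · exact Or.inl ⟨d, hr d hd, hacc, rfl⟩
    · exact Or.inr ⟨d, fun m hm => ⟨hr _ (hd m hm).1, (hd m hm).2⟩, hw⟩

end Code

/-! ### Symbolic execution of programs -/

namespace Code

variable {L : Type}

/-- Move the head of a tape `n` cells to the left. -/
def lefts (t : TapeId) : ℕ → Code L → Code L
  | 0, k => k
  | n + 1, k => .left t (lefts t n k)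

/-- Move the head of a tape `n` cells to the right. -/
def rights (t : TapeId) : ℕ → Code L → Code L
  | 0, k => k
  | n + 1, k => .right t (rights t n k)

end Code

section ConfSteps

variable {L : Type} {prog : L → Code L} {X A B o : ℕ → Bool} {x a b h : ℕ}
  {e : Cfg Bool (Code L)}

open Code

theorem reach_goto {l : L}
    (H : Reach (instr prog) (conf (prog l) X x A a B b o h) e) :
    Reach (instr prog) (conf (.goto l) X x A a B b o h) e :=
  Reach.head (by cases hX : X x <;> simp [stepOf, conf, Code.instr, hX]) H

theorem reachPlus_goto {l : L}
    (H : Reach (instr prog) (conf (prog l) X x A a B b o h) e) :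
    ReachPlus (instr prog) (conf (.goto l) X x A a B b o h) e :=
  ReachPlus.head (by cases hX : X x <;> simp [stepOf, conf, Code.instr, hX]) H

theorem reach_test_input {k₀ k₁ : Code L}
    (H : Reach (instr prog) (conf (if X x then k₁ else k₀) X x A a B b o h) e) :
    Reach (instr prog) (conf (.test .input k₀ k₁) X x A a B b o h) e :=
  Reach.head rfl H

theorem reach_test_zero {k₀ k₁ : Code L}
    (H : Reach (instr prog) (conf (if A a then k₁ else k₀) X x A a B b o h) e) :
    Reach (instr prog) (conf (.test (.work 0) k₀ k₁) X x A a B b o h) e :=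
  Reach.head rfl H

theorem reach_test_one {k₀ k₁ : Code L}
    (H : Reach (instr prog) (conf (if B b then k₁ else k₀) X x A a B b o h) e) :
    Reach (instr prog) (conf (.test (.work 1) k₀ k₁) X x A a B b o h) e :=
  Reach.head rfl H

theorem conf_update_head_input (v : ℕ) {V : Type} (q : V) :
    ({ conf q X x A a B b o h with
        head := Function.update (conf q X x A a B b o h).head .input v } : Cfg Bool V) =
      conf q X v A a B b o h := by
  unfold conf
  dsimp only
  congr 1
  funext t
  rcases t with _ | i
  · rfl
  · fin_cases i <;> rfl

theorem conf_update_head_zero (v : ℕ) {V : Type} (q : V) :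
    ({ conf q X x A a B b o h with
        head := Function.update (conf q X x A a B b o h).head (.work 0) v } : Cfg Bool V) =
      conf q X x A v B b o h := by
  unfold conf
  dsimp only
  congr 1
  funext t
  rcases t with _ | i
  · rfl
  · fin_cases i <;> rfl

theorem conf_update_head_one (v : ℕ) {V : Type} (q : V) :
    ({ conf q X x A a B b o h with
        head := Function.update (conf q X x A a B b o h).head (.work 1) v } : Cfg Bool V) =
      conf q X x A a B v o h := by
  unfold conf
  dsimp only
  congr 1
  funext t
  rcases t with _ | i
  · rfl
  · fin_cases i <;> rfl

theorem reach_right_input {k : Code L}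
    (H : Reach (instr prog) (conf k X (x + 1) A a B b o h) e) :
    Reach (instr prog) (conf (.right .input k) X x A a B b o h) e :=
  Reach.head (congrArg some (conf_update_head_input _ k)) H

theorem reach_rights_zero {k : Code L} (n : ℕ)
    (H : Reach (instr prog) (conf k X x A (a + n) B b o h) e) :
    Reach (instr prog) (conf (rights (.work 0) n k) X x A a B b o h) e := by
  induction n generalizing a with
  | zero => exact H
  | succ n ih =>
    refine Reach.head (congrArg some (conf_update_head_zero (a + 1) (rights (.work 0) n k)))
      (ih ?_)
    rw [show a + 1 + n = a + (n + 1) from by omega]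
    exact H

theorem reach_right_zero {k : Code L}
    (H : Reach (instr prog) (conf k X x A (a + 1) B b o h) e) :
    Reach (instr prog) (conf (.right (.work 0) k) X x A a B b o h) e :=
  reach_rights_zero 1 H

theorem reach_right_one {k : Code L}
    (H : Reach (instr prog) (conf k X x A a B (b + 1) o h) e) :
    Reach (instr prog) (conf (.right (.work 1) k) X x A a B b o h) e :=
  Reach.head (congrArg some (conf_update_head_one _ k)) H

theorem reach_left_input {k : Code L} (hx : x ≠ 0)
    (H : Reach (instr prog) (conf k X (x - 1) A a B b o h) e) :
    Reach (instr prog) (conf (.left .input k) X x A a B b o h) e :=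
  Reach.head ((if_neg hx).trans (congrArg some (conf_update_head_input _ k))) H

theorem reach_left_zero {k : Code L} (ha : a ≠ 0)
    (H : Reach (instr prog) (conf k X x A (a - 1) B b o h) e) :
    Reach (instr prog) (conf (.left (.work 0) k) X x A a B b o h) e :=
  Reach.head ((if_neg ha).trans (congrArg some (conf_update_head_zero _ k))) H

theorem reach_left_one {k : Code L} (hb : b ≠ 0)
    (H : Reach (instr prog) (conf k X x A a B (b - 1) o h) e) :
    Reach (instr prog) (conf (.left (.work 1) k) X x A a B b o h) e :=
  Reach.head ((if_neg hb).trans (congrArg some (conf_update_head_one _ k))) H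

theorem reach_lefts_zero {k : Code L} (n : ℕ) (hn : n ≤ a)
    (H : Reach (instr prog) (conf k X x A (a - n) B b o h) e) :
    Reach (instr prog) (conf (lefts (.work 0) n k) X x A a B b o h) e := by
  induction n generalizing a with
  | zero => exact H
  | succ n ih =>
    refine reach_left_zero (by omega) (ih (by omega) ?_)
    rw [show a - 1 - n = a - (n + 1) from by omega]
    exact H

/-- Moving too far to the left blocks the machine. -/
theorem exists_stuck_lefts_zero {k : Code L} (n : ℕ) (hn : a < n) :
    ∃ e, Reach (instr prog) (conf (lefts (.work 0) n k) X x A a B b o h) e ∧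
      stepOf (instr prog) e = none ∧ instr prog e.state ≠ .accept ∧ e.outHead = h := by
  induction n generalizing a with
  | zero => omega
  | succ n ih =>
    by_cases ha : a = 0
    · refine ⟨_, .refl, if_pos ha, ?_, rfl⟩
      exact fun h => by cases h
    · obtain ⟨e, he, H⟩ := ih (a := a - 1) (by omega)
      exact ⟨e, reach_left_zero ha he, H⟩

theorem reach_write_zero {k : Code L} {v : Bool}
    (H : Reach (instr prog) (conf k X x (Function.update A a v) (a + 1) B b o h) e) :
    Reach (instr prog) (conf (.write 0 v k) X x A a B b o h) e := by
  refine Reach.head (congrArg some ?_) H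
  unfold conf
  dsimp only
  congr 1 <;>
  · funext t
    rcases t with _ | i
    · rfl
    · fin_cases i <;> rfl

theorem reach_write_one {k : Code L} {v : Bool}
    (H : Reach (instr prog) (conf k X x A a (Function.update B b v) (b + 1) o h) e) :
    Reach (instr prog) (conf (.write 1 v k) X x A a B b o h) e := by
  refine Reach.head (congrArg some ?_) H
  unfold conf
  dsimp only
  congr 1 <;>
  · funext t
    rcases t with _ | i
    · rfl
    · fin_cases i <;> rfl

theorem reach_print {k : Code L} {v : Bool}
    (H : Reach (instr prog) (conf k X x A a B b (Function.update o h v) (h + 1)) e) :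
    Reach (instr prog) (conf (.print v k) X x A a B b o h) e :=
  Reach.head rfl H

end ConfSteps

/-! ### Two working tapes on one -/

/-- The content of a tape that carries, in blocks of five cells, a mark of the first block and,
for both working tapes, a mark of the head position and the scanned content. -/
def encTape (K T : Fin 2 → ℕ → Bool) (i : ℕ) : Bool :=
  -- In each block, working tape `j` has its head mark at offset `1 + 2 * j` and its content at
  -- offset `2 + 2 * j`.
  if i % 5 = 0 then decide (i / 5 = 0)
  else if i % 5 = 1 then K 0 (i / 5)
  else if i % 5 = 2 then T 0 (i / 5)
  else if i % 5 = 3 then K 1 (i / 5)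
  else T 1 (i / 5)

section EncTape

variable {K T : Fin 2 → ℕ → Bool}

theorem encTape_home (n : ℕ) : encTape K T (5 * n) = decide (n = 0) := by
  have h₁ : 5 * n % 5 = 0 := by omega
  have h₂ : 5 * n / 5 = n := by omega
  simp [encTape]

theorem encTape_mark (j : Fin 2) (n : ℕ) : encTape K T (5 * n + (1 + 2 * j)) = K j n := by
  fin_cases j
  · have h₁ : (5 * n + 1) % 5 = 1 := by omega
    have h₂ : (5 * n + 1) / 5 = n := by omega
    simp [encTape, h₁, h₂]
  · have h₁ : (5 * n + 3) % 5 = 3 := by omega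
    have h₂ : (5 * n + 3) / 5 = n := by omega
    simp [encTape, h₁, h₂]

theorem encTape_content (j : Fin 2) (n : ℕ) : encTape K T (5 * n + (2 + 2 * j)) = T j n := by
  fin_cases j
  · have h₁ : (5 * n + 2) % 5 = 2 := by omega
    have h₂ : (5 * n + 2) / 5 = n := by omega
    simp [encTape, h₁, h₂]
  · have h₁ : (5 * n + 4) % 5 = 4 := by omega
    have h₂ : (5 * n + 4) / 5 = n := by omega
    simp [encTape, h₁, h₂]

theorem update_encTape_mark (j : Fin 2) (n : ℕ) (v : Bool) :
    Function.update (encTape K T) (5 * n + (1 + 2 * j)) v =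
      encTape (Function.update K j (Function.update (K j) n v)) T := by
  funext i
  by_cases h : i = 5 * n + (1 + 2 * j)
  · rw [h, Function.update_self, encTape_mark, Function.update_self, Function.update_self]
  · rw [Function.update_of_ne h]
    fin_cases j
    · have h : ¬(i % 5 = 1 ∧ i / 5 = n) := by simp at h; omega
      simp only [encTape, Fin.zero_eta, Function.update_self, ne_eq, one_ne_zero,
        not_false_eq_true, Function.update_of_ne]
      split_ifs <;> try rfl
      rw [Function.update_of_ne (by tauto)]
    · have h : ¬(i % 5 = 3 ∧ i / 5 = n) := by simp at h; omega
      simp only [encTape, Fin.mk_one, Function.update_self, ne_eq, zero_ne_one,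
        not_false_eq_true, Function.update_of_ne]
      split_ifs <;> try rfl
      rw [Function.update_of_ne (by tauto)]

theorem update_encTape_content (j : Fin 2) (n : ℕ) (v : Bool) :
    Function.update (encTape K T) (5 * n + (2 + 2 * j)) v =
      encTape K (Function.update T j (Function.update (T j) n v)) := by
  funext i
  by_cases h : i = 5 * n + (2 + 2 * j)
  · rw [h, Function.update_self, encTape_content, Function.update_self, Function.update_self]
  · rw [Function.update_of_ne h]
    fin_cases j
    · have h : ¬(i % 5 = 2 ∧ i / 5 = n) := by simp at h; omega
      simp only [encTape, Fin.zero_eta, Function.update_self, ne_eq, one_ne_zero,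
        not_false_eq_true, Function.update_of_ne]
      split_ifs <;> try rfl
      rw [Function.update_of_ne (by tauto)]
    · have h : ¬(i % 5 = 4 ∧ i / 5 = n) := by simp at h; omega
      simp only [encTape, Fin.mk_one, Function.update_self, ne_eq, zero_ne_one,
        not_false_eq_true, Function.update_of_ne]
      split_ifs <;> try rfl
      rw [Function.update_of_ne (by omega)]

end EncTape

/-! ### The simulating programs -/

/-- The tasks of the simulating programs. The flag `ph` is `false` while the query is computed and
`true` after the oracle has answered. -/
inductive Task
  | setup (ph : Bool)
  | rest (ph : Bool)
  | scan (ph : Bool)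
  | home (ph : Bool)
  | countUp
  | countDown

instance : Finite Task :=
  Finite.of_surjective (fun p : Fin 6 × Bool => match p with
    | (0, ph) => Task.setup ph
    | (1, ph) => Task.rest ph
    | (2, ph) => Task.scan ph
    | (3, ph) => Task.home ph
    | (4, _) => Task.countUp
    | (5, _) => Task.countDown) (by
    rintro (ph | ph | ph | ph | _ | _)
    exacts [⟨(0, ph), rfl⟩, ⟨(1, ph), rfl⟩, ⟨(2, ph), rfl⟩, ⟨(3, ph), rfl⟩, ⟨(4, true), rfl⟩,
      ⟨(5, true), rfl⟩])

section Programs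

variable {V : Type}

open Code

/-- Return to the first cell of the first working tape and continue at the vertex `p`. -/
def returnTo (ph : Bool) (n : ℕ) (p : V) : Code (Task × V) :=
  lefts (.work 0) n (.goto (.home ph, p))

/-- Simulate an instruction, starting on the first cell of the first working tape. -/
def restCode (ph : Bool) (v : V) : Instr RevSym V → Code (Task × V)
  | .start p => .goto (.rest ph, p)
  | .test .input p q => .test .input (.goto (.rest ph, p)) (.goto (.rest ph, q))
  | .left .input p => .left .input (.goto (.rest ph, p))
  | .right .input p => .right .input (.goto (.rest ph, p))
  | .test (.work j) _ _ => rights (.work 0) (1 + 2 * j) (.goto (.scan ph, v))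
  | .left (.work j) _ => rights (.work 0) (1 + 2 * j) (.goto (.scan ph, v))
  | .right (.work j) _ => rights (.work 0) (1 + 2 * j) (.goto (.scan ph, v))
  | .write j _ _ => rights (.work 0) (1 + 2 * j) (.goto (.scan ph, v))
  | .print (.bit b) p => match ph with
    | false => .print false (.goto (.rest false, p))
    -- The head on the second working tape has passed one cell of `1^n` per mark seen. A scanned 1
    -- means that marks are still to come, so the bit is skipped; a scanned 0 means that all `n`
    -- marks have been seen.
    | true => .test (.work 1) (.print b (.goto (.rest true, p))) (.goto (.rest true, p))
  | .print .mark p => match ph with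
    | false => .right (.work 1) (.goto (.countUp, p))
    | true => .test (.work 1) .reject (.right (.work 1) (.goto (.rest true, p)))
  | .accept => match ph with
    | false => .accept
    | true => .test (.work 1) .accept .reject
  | .reject => .reject
  | .query _ _ => .reject

/-- Simulate an instruction on a working tape, starting on the mark of the head position. -/
def scanCode (ph : Bool) : Instr RevSym V → Code (Task × V)
  | .test (.work j) p q =>
      .right (.work 0) (.test (.work 0) (returnTo ph (2 + 2 * j) p) (returnTo ph (2 + 2 * j) q))
  | .left (.work j) p =>
      -- Writing moves the head one cell to the right, so six cells to the left lies the mark of the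
      -- preceding block. From the first block this leaves the tape, and the simulation blocks
      -- exactly when the simulated head cannot move left.
      .write 0 false (lefts (.work 0) 6 (.write 0 true (returnTo ph (2 + 2 * j) p)))
  | .right (.work j) p =>
      .write 0 false (rights (.work 0) 4 (.write 0 true (returnTo ph (2 + 2 * j) p)))
  | .write j b p =>
      -- Erasing the mark leads to the content cell; three cells after writing it comes the mark of
      -- the next block.
      .write 0 false (.write 0 b (rights (.work 0) 3 (.write 0 true (returnTo ph (2 + 2 * j) p))))
  | _ => .reject

/-- The programs that simulate a revising machine. -/
def simProg (R : V → Instr RevSym V) : Task × V → Code (Task × V)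
  | (.setup ph, v) =>
      -- Ones on cells 0, 1 and 3: the first block carries the home mark and both head marks.
      .write 0 true (.write 0 true (.right (.work 0) (.write 0 true
        (lefts (.work 0) 4 (.goto (.rest ph, v))))))
  | (.rest ph, v) => restCode ph v (R v)
  | (.scan ph, v) =>
      .test (.work 0) (rights (.work 0) 5 (.goto (.scan ph, v))) (scanCode ph (R v))
  | (.home ph, p) =>
      .test (.work 0) (lefts (.work 0) 5 (.goto (.home ph, p))) (.goto (.rest ph, p))
  | (.countUp, p) =>
      -- A counter value `c` is stored as ones on cells 1 to `c`. Going up prints a 1 for each of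
      -- them and one more for the new cell; cell 0 keeps its 0 and stops the way back.
      .test (.work 1) (.write 1 true (.print true (.left (.work 1) (.goto (.countDown, p)))))
        (.print true (.right (.work 1) (.goto (.countUp, p))))
  | (.countDown, p) =>
      .test (.work 1) (.print false (.goto (.rest false, p)))
        (.left (.work 1) (.goto (.countDown, p)))

/-- The marks of the positions of the heads on the working tapes. -/
def headMarks (h : TapeId → ℕ) (j : Fin 2) (n : ℕ) : Bool := decide (n = h (.work j))

/-- The configuration that represents the configuration `r` of the simulated machine. -/
def simCfg (ph : Bool) (r : Cfg RevSym V) (B : ℕ → Bool) (b : ℕ) (o : ℕ → Bool) (h : ℕ) :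
    Cfg Bool (Code (Task × V)) :=
  conf (.goto (.rest ph, r.state)) (r.tape .input) (r.head .input)
    (encTape (headMarks r.head) fun j => r.tape (.work j)) 0 B b o h

variable {R : V → Instr RevSym V} {X B o : ℕ → Bool} {x b h : ℕ} {ph : Bool}
  {e : Cfg Bool (Code (Task × V))}

theorem reach_home {K T : Fin 2 → ℕ → Bool} {p : V} (n : ℕ)
    (H : Reach (Code.instr (simProg R))
      (conf (.goto (.rest ph, p)) X x (encTape K T) 0 B b o h) e) :
    Reach (Code.instr (simProg R))
      (conf (.goto (.home ph, p)) X x (encTape K T) (5 * n) B b o h) e := by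
  induction n with
  | zero =>
    refine reach_goto (reach_test_zero ?_)
    rw [encTape_home]
    exact H
  | succ n ih =>
    refine reach_goto (reach_test_zero ?_)
    rw [encTape_home]
    exact reach_lefts_zero 5 (by omega) ih

theorem reach_returnTo {K T : Fin 2 → ℕ → Bool} {p : V} (n m a : ℕ) (ha : a = 5 * n + m)
    (H : Reach (Code.instr (simProg R))
      (conf (.goto (.rest ph, p)) X x (encTape K T) 0 B b o h) e) :
    Reach (Code.instr (simProg R))
      (conf (returnTo ph m p) X x (encTape K T) a B b o h) e := by
  refine reach_lefts_zero m (by omega) ?_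
  rw [show a - m = 5 * n by omega]
  exact reach_home n H

theorem reach_scan {T : Fin 2 → ℕ → Bool} {hd : TapeId → ℕ} {v : V} (j : Fin 2)
    (H : Reach (Code.instr (simProg R))
      (conf (scanCode ph (R v)) X x (encTape (headMarks hd) T) (5 * hd (.work j) + (1 + 2 * j))
        B b o h) e) :
    Reach (Code.instr (simProg R))
      (conf (rights (.work 0) (1 + 2 * j) (.goto (.scan ph, v))) X x (encTape (headMarks hd) T) 0
        B b o h) e := by
  have key : ∀ k n, n + k = hd (.work j) → Reach (Code.instr (simProg R))
      (conf (.goto (.scan ph, v)) X x (encTape (headMarks hd) T) (5 * n + (1 + 2 * j))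
        B b o h) e := by
    intro k
    induction k with
    | zero =>
      rintro n rfl
      refine reach_goto (reach_test_zero ?_)
      rw [encTape_mark, headMarks, decide_eq_true rfl]
      exact H
    | succ k ih =>
      intro n hn
      refine reach_goto (reach_test_zero ?_)
      rw [encTape_mark, headMarks, decide_eq_false (by omega)]
      refine reach_rights_zero 5 ?_
      rw [show 5 * n + (1 + 2 * (j : ℕ)) + 5 = 5 * (n + 1) + (1 + 2 * j) by omega]
      exact ih (n + 1) (by omega)
  refine reach_rights_zero _ ?_
  have := key (hd (.work j)) 0 (by omega)
  rwa [mul_zero] at this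

/-- The left side has the form that two uses of `update_encTape_mark` produce: erase the old mark,
then set the new one. -/
theorem headMarks_update (hd : TapeId → ℕ) (j : Fin 2) (m : ℕ) :
    Function.update
      (Function.update (headMarks hd) j (Function.update (headMarks hd j) (hd (.work j)) false)) j
      (Function.update (Function.update (headMarks hd) j
        (Function.update (headMarks hd j) (hd (.work j)) false) j) m true) =
      headMarks (Function.update hd (.work j) m) := by
  rw [Function.update_self, Function.update_idem]
  funext i n
  by_cases hi : i = j
  · subst hi
    rw [Function.update_self, headMarks, Function.update_self]
    by_cases hn : n = m
    · simp [hn]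
    · rw [Function.update_of_ne hn, decide_eq_false hn]
      by_cases hn' : n = hd (.work i)
      · rw [hn', Function.update_self]
      · rw [Function.update_of_ne hn', headMarks, decide_eq_false hn']
  · rw [Function.update_of_ne hi, headMarks, headMarks, Function.update_of_ne (by simpa using hi)]

theorem work_update (tp : TapeId → ℕ → Bool) (j : Fin 2) (f : ℕ → Bool) :
    (fun i => Function.update tp (.work j) f (.work i)) =
      Function.update (fun i => tp (.work i)) j f := by
  funext i
  by_cases hi : i = j
  · subst hi
    rw [Function.update_self, Function.update_self]
  · rw [Function.update_of_ne hi, Function.update_of_ne (by simpa using hi)]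

/-- A step of the simulated machine that does not print anything is simulated. -/
theorem reachPlus_simCfg {r r' : Cfg RevSym V} (hr : stepOf R r = some r')
    (hp : ∀ g p, R r.state ≠ .print g p) :
    ReachPlus (Code.instr (simProg R)) (simCfg ph r B b o h) (simCfg ph r' B b o h) ∧
      r'.out = r.out ∧ r'.outHead = r.outHead := by
  unfold stepOf at hr
  cases hI : R r.state with
  | print g p => exact absurd hI (hp g p)
  | accept | reject | query => rw [hI] at hr; cases hr
  | start p =>
    rw [hI] at hr
    obtain rfl := Option.some.inj hr
    refine ⟨reachPlus_goto ?_, rfl, rfl⟩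
    rw [simProg, hI]
    exact .refl
  | test t p q =>
    rw [hI] at hr
    obtain rfl := Option.some.inj hr
    refine ⟨reachPlus_goto ?_, rfl, rfl⟩
    rw [simProg, hI]
    cases t with
    | input =>
      refine reach_test_input ?_
      unfold simCfg
      dsimp only
      cases r.tape .input (r.head .input) <;> exact .refl
    | work j =>
      refine reach_scan j ?_
      rw [hI]
      refine reach_right_zero (reach_test_zero ?_)
      rw [show 5 * r.head (.work j) + (1 + 2 * (j : ℕ)) + 1 =
        5 * r.head (.work j) + (2 + 2 * j) by omega, encTape_content]
      unfold simCfg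
      dsimp only
      cases r.tape (.work j) (r.head (.work j)) <;> exact reach_returnTo _ _ _ rfl .refl
  | left t p =>
    rw [hI] at hr
    dsimp only at hr
    split_ifs at hr with h0
    obtain rfl := Option.some.inj hr
    refine ⟨reachPlus_goto ?_, rfl, rfl⟩
    rw [simProg, hI]
    cases t with
    | input => exact reach_left_input h0 .refl
    | work j =>
      refine reach_scan j ?_
      rw [hI]
      refine reach_write_zero (reach_lefts_zero 6 (by omega) ?_)
      rw [update_encTape_mark]
      refine reach_write_zero ?_
      rw [show 5 * r.head (.work j) + (1 + 2 * (j : ℕ)) + 1 - 6 =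
        5 * (r.head (.work j) - 1) + (1 + 2 * j) by omega, update_encTape_mark, headMarks_update]
      exact reach_returnTo (r.head (.work j) - 1) _ _ (by omega) .refl
  | right t p =>
    rw [hI] at hr
    obtain rfl := Option.some.inj hr
    refine ⟨reachPlus_goto ?_, rfl, rfl⟩
    rw [simProg, hI]
    cases t with
    | input => exact reach_right_input .refl
    | work j =>
      refine reach_scan j ?_
      rw [hI]
      refine reach_write_zero (reach_rights_zero 4 ?_)
      rw [update_encTape_mark]
      refine reach_write_zero ?_
      rw [show 5 * r.head (.work j) + (1 + 2 * (j : ℕ)) + 1 + 4 =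
        5 * (r.head (.work j) + 1) + (1 + 2 * j) by omega, update_encTape_mark, headMarks_update]
      exact reach_returnTo (r.head (.work j) + 1) _ _ (by omega) .refl
  | write j v p =>
    rw [hI] at hr
    obtain rfl := Option.some.inj hr
    refine ⟨reachPlus_goto ?_, rfl, rfl⟩
    rw [simProg, hI]
    refine reach_scan j ?_
    rw [hI]
    refine reach_write_zero (reach_write_zero (reach_rights_zero 3 (reach_write_zero ?_)))
    rw [show 5 * r.head (.work j) + (1 + 2 * (j : ℕ)) + 1 =
      5 * r.head (.work j) + (2 + 2 * j) by omega,
      show 5 * r.head (.work j) + (2 + 2 * (j : ℕ)) + 1 + 3 =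
        5 * (r.head (.work j) + 1) + (1 + 2 * j) by omega,
      update_encTape_mark, update_encTape_content, update_encTape_mark, headMarks_update]
    refine reach_returnTo (r.head (.work j) + 1) _ _ (by omega) ?_
    unfold simCfg
    dsimp only
    rw [work_update]
    exact .refl

/-- Where the simulated machine blocks or rejects, so does the simulation. -/
theorem exists_stuck_simCfg {r : Cfg RevSym V} (hr : stepOf R r = none)
    (hacc : R r.state ≠ .accept) :
    ∃ e, Reach (Code.instr (simProg R)) (simCfg ph r B b o h) e ∧
      stepOf (Code.instr (simProg R)) e = none ∧ Code.instr (simProg R) e.state ≠ .accept ∧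
      e.outHead = h := by
  unfold stepOf at hr
  suffices ∃ e, Reach (Code.instr (simProg R)) (conf (simProg R (.rest ph, r.state))
      (r.tape .input) (r.head .input)
      (encTape (headMarks r.head) fun j => r.tape (.work j)) 0 B b o h) e ∧
      stepOf (Code.instr (simProg R)) e = none ∧ Code.instr (simProg R) e.state ≠ .accept ∧
      e.outHead = h by
    obtain ⟨e, he, H⟩ := this
    exact ⟨e, reach_goto he, H⟩
  rw [simProg]
  cases hI : R r.state with
  | accept => exact absurd hI hacc
  | reject | query => exact ⟨_, .refl, rfl, (fun h => by cases h), rfl⟩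
  | left t p =>
    rw [hI] at hr
    dsimp only at hr
    split_ifs at hr with h0
    cases t with
    | input => exact ⟨_, .refl, if_pos h0, (fun h => by cases h), rfl⟩
    | work j =>
      -- The simulated head is on cell 0, so the position is 2 or 4, less than the six moves
      -- demanded.
      have h6 : 5 * r.head (.work j) + (1 + 2 * (j : ℕ)) + 1 < 6 := by have := j.2; omega
      obtain ⟨e, he, H⟩ := exists_stuck_lefts_zero (prog := simProg R) (X := r.tape .input)
        (A := Function.update (encTape (headMarks r.head) fun j => r.tape (.work j))
          (5 * r.head (.work j) + (1 + 2 * (j : ℕ))) false)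
        (B := B) (o := o) (x := r.head .input) (b := b) (h := h)
        (k := .write 0 true (returnTo ph (2 + 2 * j) p)) 6 h6
      refine ⟨e, reach_scan j ?_, H⟩
      rw [hI]
      exact reach_write_zero he
  | _ => rw [hI] at hr; cases hr

theorem reach_setup {v : V} {O : ℕ → RevSym} :
    Reach (Code.instr (simProg R))
      (conf (simProg R (.setup ph, v)) X 0 (fun _ => false) 0 B b o h)
      (simCfg ph (conf v X 0 (fun _ => false) 0 (fun _ => false) 0 O 0) B b o h) := by
  have key : Function.update (Function.update (Function.update (fun _ : ℕ => false) 0 true) 1 true)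
      3 true = encTape
        (headMarks (conf v X 0 (fun _ => false) 0 (fun _ => false) 0 O 0).head)
        fun j => (conf v X 0 (fun _ => false) 0 (fun _ => false) 0 O 0).tape (.work j) := by
    funext i
    simp only [Function.update_apply, encTape, headMarks, conf]
    split_ifs <;> first | omega | simp <;> omega
  rw [simProg]
  refine reach_write_zero (reach_write_zero (reach_right_zero (reach_write_zero
    (reach_lefts_zero 4 (by omega) ?_))))
  unfold simCfg
  rw [← key]
  exact .refl

end Programs

/-! ### Counting marks and encoding sequences -/

/-- Whether a symbol is the revising mark. -/
def RevSym.isMark : RevSym → Bool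
  | .bit _ => false
  | .mark => true

/-- The number of revising marks among the first `h` symbols. -/
def markCount (z : ℕ → RevSym) (h : ℕ) : ℕ := Nat.count (fun i => (z i).isMark = true) h

theorem markCount_zero (z : ℕ → RevSym) : markCount z 0 = 0 := Nat.count_zero _

theorem markCount_succ (z : ℕ → RevSym) (h : ℕ) :
    markCount z (h + 1) = markCount z h + if (z h).isMark then 1 else 0 := Nat.count_succ _ _

theorem markCount_mono (z : ℕ → RevSym) : Monotone (markCount z) := Nat.count_monotone _

theorem markCount_congr {z z' : ℕ → RevSym} {h : ℕ} (H : ∀ i < h, z i = z' i) :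
    markCount z h = markCount z' h := by
  induction h with
  | zero => simp [markCount_zero]
  | succ h ih =>
    rw [markCount_succ, markCount_succ, ih fun i hi => H i (by omega), H h (by omega)]

/-- The number of ones that are printed in the query when the `k`-th symbol is printed. -/
def width (z : ℕ → RevSym) (k : ℕ) : ℕ := if (z k).isMark then markCount z (k + 1) else 0

/-- The length of the encoding of the first `k` values of a sequence. -/
def codeLength (w : ℕ → ℕ) (k : ℕ) : ℕ := ∑ i ∈ Finset.range k, (w i + 1)

theorem codeLength_succ (w : ℕ → ℕ) (k : ℕ) :
    codeLength w (k + 1) = codeLength w k + (w k + 1) := Finset.sum_range_succ _ _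

theorem strictMono_codeLength (w : ℕ → ℕ) : StrictMono (codeLength w) :=
  strictMono_nat_of_lt_succ fun k => by rw [codeLength_succ]; omega

open Classical in
/-- The encoding of a sequence. -/
noncomputable def encodeSeq (w : ℕ → ℕ) (j : ℕ) : Bool :=
  !decide (∃ k, j + 1 = codeLength w (k + 1))

theorem encodesSeq_encodeSeq (w : ℕ → ℕ) : EncodesSeq (encodeSeq w) w := by
  intro j
  simp only [encodeSeq, codeLength, Bool.not_eq_false']
  classical exact decide_eq_true_iff

/-- Here `j + 1` lies strictly between the consecutive values `codeLength w k` and `codeLength w (k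
+ 1)`, so no block ends at `j`. -/
theorem encodeSeq_eq_true {w : ℕ → ℕ} {k j : ℕ} (h₁ : codeLength w k ≤ j)
    (h₂ : j < codeLength w k + w k) : encodeSeq w j = true := by
  simp only [encodeSeq, Bool.not_eq_true', decide_eq_false_iff_not]
  rintro ⟨m, hm⟩
  have h₃ : codeLength w k < codeLength w (m + 1) := by omega
  have h₄ : codeLength w (m + 1) < codeLength w (k + 1) := by rw [codeLength_succ w k]; omega
  have h₅ := (strictMono_codeLength w).lt_iff_lt.1 h₃
  have h₆ := (strictMono_codeLength w).lt_iff_lt.1 h₄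
  omega

theorem encodeSeq_eq_false (w : ℕ → ℕ) (k : ℕ) : encodeSeq w (codeLength w k + w k) = false := by
  simp only [encodeSeq, Bool.not_eq_false', decide_eq_true_iff]
  exact ⟨k, by rw [codeLength_succ]; omega⟩

/-- The encoding is injective: the zeros of `p` determine the range of the strictly increasing
function `k ↦ codeLength w (k + 1)`, hence the function and its differences `w k + 1`. -/
theorem subsingleton_maxOracle (p : ℕ → Bool) : (maxOracle p).Subsingleton := by
  rintro _ ⟨w, n, hw, hn, rfl⟩ _ ⟨w', n', hw', hn', rfl⟩
  have key : (fun k => codeLength w (k + 1)) = fun k => codeLength w' (k + 1) := by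
    have hm : ∀ w : ℕ → ℕ, StrictMono fun k => codeLength w (k + 1) := fun w =>
      (strictMono_codeLength w).comp fun a b h => Nat.succ_lt_succ h
    refine ((hm w).range_inj (hm w')).1 (Set.ext fun j => ?_)
    rcases j with _ | j
    · constructor <;>
      · rintro ⟨k, hk⟩
        simp [codeLength_succ] at hk
    · have := (hw j).symm.trans (hw' j)
      constructor
      · rintro ⟨k, hk⟩
        obtain ⟨k', hk'⟩ := this.1 ⟨k, hk.symm⟩
        exact ⟨k', hk'.symm⟩
      · rintro ⟨k, hk⟩
        obtain ⟨k', hk'⟩ := this.2 ⟨k, hk.symm⟩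
        exact ⟨k', hk'.symm⟩
  have key' : ∀ k, codeLength w k = codeLength w' k := by
    rintro (_ | k)
    · rfl
    · exact congrFun key k
  obtain rfl : w = w' := by
    funext k
    have h₁ := key' k
    have h₂ := key' (k + 1)
    rw [codeLength_succ, codeLength_succ] at h₂
    omega
  rw [hn.unique hn']

/-- The first `k` symbols of a sequence, followed by zeros. -/
def prefixOf (p : ℕ → Bool) (k : ℕ) (i : ℕ) : Bool := decide (i < k) && p i

theorem update_prefixOf {p : ℕ → Bool} {k : ℕ} {v : Bool} (h : p k = v) :
    Function.update (prefixOf p k) k v = prefixOf p (k + 1) := by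
  subst h
  funext i
  rcases lt_trichotomy i k with hi | rfl | hi
  · rw [Function.update_of_ne hi.ne]
    simp [prefixOf, hi, Nat.lt_succ_of_lt hi]
  · simp [prefixOf]
  · rw [Function.update_of_ne hi.ne']
    simp [prefixOf, hi.not_gt, show ¬ i < k + 1 by omega]

/-- The second working tape during the computation of the query, when `c` marks have been
counted. -/
def counterTape (c i : ℕ) : Bool := decide (1 ≤ i ∧ i ≤ c)

/-! ### First run: the query -/

section Query

variable {V : Type} {R : V → Instr RevSym V} {X A p : ℕ → Bool} {x a h : ℕ}
  {e : Cfg Bool (Code (Task × V))}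

open Code

theorem reach_countDown {c b : ℕ} {v : V} {o : ℕ → Bool} (hb : b ≤ c)
    (H : Reach (Code.instr (simProg R)) (conf (.goto (.rest false, v)) X x A a (counterTape c) 0
      (Function.update o h false) (h + 1)) e) :
    Reach (Code.instr (simProg R)) (conf (.goto (.countDown, v)) X x A a (counterTape c) b o h)
      e := by
  induction b with
  | zero =>
    refine reach_goto (reach_test_one ?_)
    exact reach_print H
  | succ b ih =>
    refine reach_goto (reach_test_one ?_)
    rw [counterTape, decide_eq_true (by omega)]
    exact reach_left_one (by omega) (ih (by omega))

theorem reach_countUp {c : ℕ} {v : V} (hp : ∀ i < c + 1, p (h + i) = true)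
    (H : Reach (Code.instr (simProg R)) (conf (.goto (.countDown, v)) X x A a
      (counterTape (c + 1)) (c + 1) (prefixOf p (h + (c + 1))) (h + (c + 1))) e) :
    Reach (Code.instr (simProg R)) (conf (.goto (.countUp, v)) X x A a (counterTape c) 1
      (prefixOf p h) h) e := by
  have key : ∀ k i, i + k = c → Reach (Code.instr (simProg R)) (conf (.goto (.countUp, v)) X x A a
      (counterTape c) (1 + i) (prefixOf p (h + i)) (h + i)) e := by
    intro k
    induction k with
    | zero =>
      rintro i rfl
      refine reach_goto (reach_test_one ?_)
      rw [counterTape, decide_eq_false (by omega)]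
      refine reach_write_one (reach_print (reach_left_one (by omega) ?_))
      rw [update_prefixOf (hp i (by omega))]
      have : Function.update (counterTape (i + 0)) (1 + i) true = counterTape (i + 0 + 1) := by
        funext n
        by_cases hn : n = 1 + i
        · rw [hn, Function.update_self, counterTape, decide_eq_true (by omega)]
        · rw [Function.update_of_ne hn, counterTape, counterTape, decide_eq_decide]
          omega
      rw [this, show 1 + i + 1 - 1 = i + 0 + 1 by omega]
      exact H
    | succ k ih =>
      intro i hi
      refine reach_goto (reach_test_one ?_)
      rw [counterTape, decide_eq_true (by omega)]
      refine reach_print (reach_right_one ?_)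
      rw [update_prefixOf (hp i (by omega))]
      exact ih (i + 1) (by omega)
  exact key c 0 (by omega)

/-- The configuration that represents the configuration `r` during the computation of the query,
where `z` is the output of the simulated machine. -/
noncomputable def queryPhaseCfg (z : ℕ → RevSym) (r : Cfg RevSym V) :
    Cfg Bool (Code (Task × V)) :=
  simCfg false r (counterTape (markCount z r.outHead)) 0
    (prefixOf (encodeSeq (width z)) (codeLength (width z) r.outHead))
    (codeLength (width z) r.outHead)

theorem stepOf_print {r r' : Cfg RevSym V} {g : RevSym} {v : V} (hI : R r.state = .print g v)
    (hr : stepOf R r = some r') :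
    r' = { r with
      state := v
      out := Function.update r.out r.outHead g
      outHead := r.outHead + 1 } := by
  unfold stepOf at hr
  rw [hI] at hr
  exact (Option.some.inj hr).symm

/-- Each symbol of `z` prints one block of the encoding of `width z`: a bit prints `0`, the `m`-th
mark prints `1^m 0` and raises the counter to `m`. -/
theorem reachPlus_queryPhaseCfg {z : ℕ → RevSym} {r r' : Cfg RevSym V}
    (hr : stepOf R r = some r') (hz : ∀ i < r'.outHead, r'.out i = z i) :
    ReachPlus (Code.instr (simProg R)) (queryPhaseCfg z r) (queryPhaseCfg z r') := by
  by_cases hp : ∃ g v, R r.state = .print g v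
  · obtain ⟨g, v, hI⟩ := hp
    obtain rfl := stepOf_print hI hr
    have hg : z r.outHead = g := by
      rw [← hz r.outHead (Nat.lt_succ_self _)]
      exact Function.update_self ..
    refine reachPlus_goto ?_
    unfold queryPhaseCfg simCfg
    dsimp only
    rw [codeLength_succ, markCount_succ, hg, simProg, hI]
    cases g with
    | bit b =>
      refine reach_print ?_
      have hw : width z r.outHead = 0 := by simp [width, hg, RevSym.isMark]
      rw [update_prefixOf (by simpa [hw] using encodeSeq_eq_false (width z) r.outHead), hw]
      exact .refl
    | mark =>
      refine reach_right_one ?_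
      have hw : width z r.outHead = markCount z r.outHead + 1 := by
        simp [width, hg, RevSym.isMark, markCount_succ]
      refine reach_countUp (fun i hi => ?_) (reach_countDown le_rfl ?_)
      · exact encodeSeq_eq_true (k := r.outHead) (by omega) (by omega)
      · rw [← hw, update_prefixOf (encodeSeq_eq_false (width z) r.outHead)]
        simp only [hw, RevSym.isMark, if_true]
        exact .refl
  · have hp' : ∀ g v, R r.state ≠ .print g v := fun g v h => hp ⟨g, v, h⟩
    unfold queryPhaseCfg
    -- Only the equality of the output heads is extracted here, so the tape arguments are arbitrary.
    rw [(reachPlus_simCfg (ph := false) (B := fun _ => false) (o := fun _ => false) (b := 0)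
      (h := 0) hr hp').2.2]
    exact (reachPlus_simCfg hr hp').1

theorem reach_queryPhaseCfg {z : ℕ → RevSym} {r r' : Cfg RevSym V}
    (hr : Reach R r r') (hz : ∀ i < r'.outHead, r'.out i = z i) :
    Reach (Code.instr (simProg R)) (queryPhaseCfg z r) (queryPhaseCfg z r') := by
  induction hr with
  | refl => exact .refl
  | @tail s t _ h ih =>
    have hst : Reach R s t := .single h
    exact (ih fun i hi => (hst.out_eq hi).symm.trans
      (hz i (lt_of_lt_of_le hi hst.outHead_le))).trans (reachPlus_queryPhaseCfg h hz).toReach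

/-- If the simulated machine yields `z`, then the query is the encoding of `width z`. -/
theorem runYields_queryPhase {z : ℕ → RevSym} {r : Cfg RevSym V} (hr : RunYields R r z)
    (hr₀ : r.outHead = 0) (hout : ∀ i, r.out i = .bit false) :
    RunYields (Code.instr (simProg R)) (queryPhaseCfg z r) (encodeSeq (width z)) := by
  rcases hr.cases with ⟨d, hd, hacc, rfl⟩ | ⟨hk, -⟩
  · refine Or.inl ⟨_, (reach_queryPhaseCfg hd fun _ _ => rfl).trans (reach_goto .refl), ?_, ?_⟩
    · show Code.instr (simProg R) (restCode false d.state (R d.state)) = .accept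
      rw [hacc]
      rfl
    · show prefixOf _ _ = _
      funext j
      by_cases hj : j < codeLength (width d.out) d.outHead
      · simp [prefixOf, hj]
      -- Beyond the output head of `R` there are blanks, which are bits. Each contributes the block
      -- `0`, in agreement with the blank rest of the output tape of `M`.
      · have hw : ∀ k, codeLength (width d.out) (d.outHead + k) =
            codeLength (width d.out) d.outHead + k := by
          intro k
          induction k with
          | zero => rfl
          | succ k ih =>
            have : width d.out (d.outHead + k) = 0 := by
              rw [width, hd.out_eq_of_ge (Nat.le_add_right _ _), hout]
              rfl
            rw [← add_assoc, codeLength_succ, ih, this]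
            omega
        have := encodeSeq_eq_false (width d.out)
          (d.outHead + (j - codeLength (width d.out) d.outHead))
        have h0 : width d.out (d.outHead + (j - codeLength (width d.out) d.outHead)) = 0 := by
          rw [width, hd.out_eq_of_ge (Nat.le_add_right _ _), hout]
          rfl
        rw [hw, h0, show codeLength (width d.out) d.outHead +
          (j - codeLength (width d.out) d.outHead) + 0 = j by omega] at this
        simp [prefixOf, hj, this]
  · refine runYields_of_unbounded fun k => ?_
    obtain ⟨d, hd, hkd⟩ := hk k
    have hz : ∀ i < d.outHead, d.out i = z i := fun i hi => hr.out_eq hr₀ hd hi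
    refine ⟨_, reach_queryPhaseCfg hd hz, ?_, fun i hi => ?_⟩
    · exact hkd.trans (strictMono_codeLength _).le_apply
    · have hi : i < codeLength (width z) d.outHead := hi
      simp [queryPhaseCfg, simCfg, conf, prefixOf, hi]

/-- The answer to the query is the number of marks. -/
theorem mem_maxOracle {z : ℕ → RevSym} {N : ℕ} (hN : ∀ k, N = k + 1 → z k = .mark)
    (hbit : ∀ i, (z (N + i)).isMark = false) :
    (fun i => decide (i < markCount z N)) ∈ maxOracle (encodeSeq (width z)) := by
  have hle : ∀ k, markCount z k ≤ markCount z N := by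
    intro k
    rcases le_total k N with hk | hk
    · exact markCount_mono z hk
    · obtain ⟨i, rfl⟩ := Nat.exists_eq_add_of_le hk
      clear hk
      induction i with
      | zero => rfl
      | succ i ih => rw [← add_assoc, markCount_succ, hbit]; simpa using ih
  refine ⟨width z, markCount z N, encodesSeq_encodeSeq _, ⟨?_, ?_⟩, rfl⟩
  -- The maximum is attained at the last mark, or at position 0 if there is no mark at all.
  · rcases N with _ | N
    · refine ⟨0, ?_⟩
      have := hbit 0
      rw [zero_add] at this
      simp [width, this, markCount_zero]
    · exact ⟨N, by simp [width, hN N rfl, RevSym.isMark]⟩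
  · rintro _ ⟨k, rfl⟩
    unfold width
    split_ifs
    · exact hle _
    · exact Nat.zero_le _

end Query

/-! ### Second run: after the answer -/

/-- `N` is the position after the last of the first `n` marks of `z`. -/
def IsStart (z : ℕ → RevSym) (n N : ℕ) : Prop :=
  markCount z N = n ∧ ∀ k, N = k + 1 → z k = .mark

theorem IsStart.congr {z z' : ℕ → RevSym} {n N : ℕ} (h : IsStart z n N)
    (H : ∀ i < N, z i = z' i) : IsStart z' n N :=
  ⟨(markCount_congr H).symm.trans h.1, fun k hk => (H k (by omega)).symm.trans (h.2 k hk)⟩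

/-- A later such position would itself follow a mark, and that mark would raise the count above `n`.
-/
theorem IsStart.unique {z : ℕ → RevSym} {n N N' : ℕ} (h : IsStart z n N) (h' : IsStart z n N') :
    N = N' := by
  have aux : ∀ {N N'}, IsStart z n N → IsStart z n N' → ¬ N < N' := by
    rintro N (_ | N') h h' hlt
    · omega
    · have h₁ := h'.1
      rw [markCount_succ, h'.2 N' rfl, ← h.1] at h₁
      have h₂ := markCount_mono z (Nat.lt_succ_iff.1 hlt)
      simp [RevSym.isMark] at h₁
      omega
  exact le_antisymm (not_lt.1 (aux h' h)) (not_lt.1 (aux h h'))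

/-- The first `h` cells of `o` are what a machine that skips `n` marks prints, after the
first `l` symbols of `z`. -/
def SkipsTo (n : ℕ) (z : ℕ → RevSym) (l : ℕ) (o : ℕ → Bool) (h : ℕ) : Prop :=
  (∀ i, h ≤ i → o i = false) ∧
  ((markCount z l < n ∧ h = 0) ∨
    (markCount z l = n ∧ ∃ N, N + h = l ∧ IsStart z n N ∧ ∀ i < h, z (N + i) = .bit (o i)))

theorem skipsTo_zero (n : ℕ) (z : ℕ → RevSym) : SkipsTo n z 0 (fun _ => false) 0 := by
  refine ⟨fun _ _ => rfl, ?_⟩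
  rw [markCount_zero]
  rcases Nat.eq_zero_or_pos n with rfl | hn
  · exact Or.inr ⟨rfl, 0, rfl, ⟨markCount_zero z, fun k hk => by omega⟩, fun i hi => by omega⟩
  · exact Or.inl ⟨hn, rfl⟩

section Answer

variable {V : Type} {R : V → Instr RevSym V}

open Code

/-- The configuration that represents the configuration `r` after the oracle has answered `n`. -/
def answerPhaseCfg (n : ℕ) (r : Cfg RevSym V) (o : ℕ → Bool) (h : ℕ) :
    Cfg Bool (Code (Task × V)) :=
  simCfg true r (fun i => decide (i < n)) (markCount r.out r.outHead) o h

/-- `SkipsTo` is the invariant of the second run: nothing is printed before the `n`-th mark, and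
afterwards exactly the bits of `R`. It persists as long as no mark beyond the `n`-th is printed. -/
theorem reachPlus_answerPhaseCfg {n : ℕ} {r r' : Cfg RevSym V} {o : ℕ → Bool} {h : ℕ}
    (hs : SkipsTo n r.out r.outHead o h) (hr : stepOf R r = some r')
    (hn : markCount r'.out r'.outHead ≤ n) :
    ∃ o' h', SkipsTo n r'.out r'.outHead o' h' ∧
      ReachPlus (Code.instr (simProg R)) (answerPhaseCfg n r o h) (answerPhaseCfg n r' o' h') := by
  by_cases hp : ∃ g v, R r.state = .print g v
  · obtain ⟨g, v, hI⟩ := hp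
    obtain rfl := stepOf_print hI hr
    have hagree : ∀ i < r.outHead, r.out i = Function.update r.out r.outHead g i :=
      fun i hi => (Function.update_of_ne hi.ne _ _).symm
    have hcount : markCount (Function.update r.out r.outHead g) (r.outHead + 1) =
        markCount r.out r.outHead + if g.isMark then 1 else 0 := by
      rw [markCount_succ, Function.update_self, markCount_congr hagree]
    dsimp only at hn ⊢
    rw [hcount] at hn
    unfold answerPhaseCfg
    dsimp only
    obtain ⟨hs₁, hs₂⟩ := hs
    unfold SkipsTo
    rw [hcount]
    cases g with
    | bit b =>
      simp only [RevSym.isMark, Bool.false_eq_true, if_false, add_zero]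
      rcases hs₂ with ⟨hlt, rfl⟩ | ⟨heq, N, hN, hst, hbits⟩
      · refine ⟨o, 0, ⟨hs₁, Or.inl ⟨hlt, rfl⟩⟩, reachPlus_goto ?_⟩
        rw [simProg, hI]
        refine reach_test_one ?_
        rw [decide_eq_true hlt]
        exact .refl
      · refine ⟨Function.update o h b, h + 1, ⟨fun i hi => ?_, Or.inr ⟨heq, N, by omega,
          hst.congr fun i hi => hagree i (by omega), fun i hi => ?_⟩⟩, reachPlus_goto ?_⟩
        · rw [Function.update_of_ne (by omega), hs₁ i (by omega)]
        · rcases Nat.lt_succ_iff_lt_or_eq.1 hi with hi | rfl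
          · rw [← hagree _ (by omega), hbits i hi, Function.update_of_ne hi.ne]
          · rw [hN, Function.update_self, Function.update_self]
        · rw [simProg, hI]
          refine reach_test_one ?_
          rw [decide_eq_false (by omega)]
          exact reach_print .refl
    | mark =>
      simp only [RevSym.isMark, if_true] at hn ⊢
      rcases hs₂ with ⟨hlt, rfl⟩ | ⟨heq, -⟩
      · refine ⟨o, 0, ⟨hs₁, ?_⟩, reachPlus_goto ?_⟩
        · rcases hn.lt_or_eq with hn | hn
          · exact Or.inl ⟨hn, rfl⟩
          -- The mark just printed is the `n`-th one, so printing starts at the next position.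
          · refine Or.inr ⟨hn, r.outHead + 1, rfl, ⟨?_, fun k hk => ?_⟩, fun i hi => by omega⟩
            · rw [hcount]
              exact hn
            · obtain rfl : r.outHead = k := by omega
              exact Function.update_self ..
        · rw [simProg, hI]
          refine reach_test_one ?_
          rw [decide_eq_true hlt]
          exact reach_right_one .refl
      · omega
  · have hp' : ∀ g v, R r.state ≠ .print g v := fun g v h => hp ⟨g, v, h⟩
    have key := fun B b => reachPlus_simCfg (ph := true) (B := B) (o := o) (b := b) (h := h) hr hp'
    obtain ⟨-, h₁, h₂⟩ := key (fun _ => false) 0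
    refine ⟨o, h, ?_, ?_⟩
    · rw [h₁, h₂]
      exact hs
    · unfold answerPhaseCfg
      rw [h₁, h₂]
      exact (key _ _).1

theorem markCount_le_of_skipsTo {n l h : ℕ} {z : ℕ → RevSym} {o : ℕ → Bool}
    (hs : SkipsTo n z l o h) : markCount z l ≤ n := by
  rcases hs with ⟨-, h | h⟩
  · exact h.1.le
  · exact h.1.le

theorem reach_accept_answerPhaseCfg {n : ℕ} {r : Cfg RevSym V} {o : ℕ → Bool} {h : ℕ}
    (hacc : R r.state = .accept) (hn : markCount r.out r.outHead = n) :
    ∃ e, Reach (Code.instr (simProg R)) (answerPhaseCfg n r o h) e ∧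
      Code.instr (simProg R) e.state = .accept ∧ e.out = o ∧ e.outHead = h := by
  refine ⟨{ answerPhaseCfg n r o h with state := .accept }, reach_goto (e := { answerPhaseCfg n r o h with state := .accept }) ?_, rfl,
    rfl, rfl⟩
  rw [simProg, hacc]
  refine reach_test_one ?_
  rw [decide_eq_false (by omega)]
  exact .refl

/-- A configuration is simulated one step further, or the simulation ends. -/
theorem answerPhaseCfg_cases {n : ℕ} {r : Cfg RevSym V} {o : ℕ → Bool} {h : ℕ}
    (hs : SkipsTo n r.out r.outHead o h) :
    (∃ r' o' h', stepOf R r = some r' ∧ SkipsTo n r'.out r'.outHead o' h' ∧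
      ReachPlus (Code.instr (simProg R)) (answerPhaseCfg n r o h) (answerPhaseCfg n r' o' h')) ∨
    ∃ e, Reach (Code.instr (simProg R)) (answerPhaseCfg n r o h) e ∧
      stepOf (Code.instr (simProg R)) e = none ∧ e.outHead = h ∧
      (Code.instr (simProg R) e.state = .accept →
        R r.state = .accept ∧ markCount r.out r.outHead = n ∧ e.out = o) := by
  cases hr : stepOf R r with
  | none =>
    right
    by_cases hacc : R r.state = .accept
    · by_cases hn : markCount r.out r.outHead = n
      · obtain ⟨e, he, he', ho, hh⟩ := reach_accept_answerPhaseCfg (o := o) (h := h) hacc hn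
        exact ⟨e, he, stepOf_accept he', hh, fun _ => ⟨hacc, hn, ho⟩⟩
      · have hlt := lt_of_le_of_ne (markCount_le_of_skipsTo hs) hn
        refine ⟨{ answerPhaseCfg n r o h with state := .reject },
          reach_goto (e := { answerPhaseCfg n r o h with state := .reject }) ?_, rfl, rfl, fun h => by cases h⟩
        rw [simProg, hacc]
        refine reach_test_one ?_
        rw [decide_eq_true hlt]
        exact .refl
    · obtain ⟨e, he, he', hne, hh⟩ := exists_stuck_simCfg (ph := true)
        (B := fun i => decide (i < n)) (o := o) (b := markCount r.out r.outHead) (h := h) hr hacc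
      exact ⟨e, he, he', hh, fun h => absurd h hne⟩
  | some r' =>
    by_cases hn : markCount r'.out r'.outHead ≤ n
    · obtain ⟨o', h', hs', H⟩ := reachPlus_answerPhaseCfg hs hr hn
      exact Or.inl ⟨r', o', h', rfl, hs', H⟩
    · right
      have hle := markCount_le_of_skipsTo hs
      by_cases hp : ∃ g v, R r.state = .print g v
      · obtain ⟨g, v, hI⟩ := hp
        obtain rfl := stepOf_print hI hr
        have hagree : ∀ i < r.outHead, Function.update r.out r.outHead g i = r.out i :=
          fun i hi => Function.update_of_ne hi.ne _ _
        dsimp only at hn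
        rw [markCount_succ, Function.update_self, markCount_congr hagree] at hn
        cases g with
        | bit b => simp [RevSym.isMark] at hn; omega
        | mark =>
          refine ⟨{ answerPhaseCfg n r o h with state := .reject },
            reach_goto (e := { answerPhaseCfg n r o h with state := .reject }) ?_, rfl, rfl, fun h => by cases h⟩
          rw [simProg, hI]
          refine reach_test_one ?_
          simp only [RevSym.isMark, if_true] at hn
          rw [decide_eq_false (by omega)]
          exact .refl
      · have hp' : ∀ g v, R r.state ≠ .print g v := fun g v h => hp ⟨g, v, h⟩
        obtain ⟨-, h₁, h₂⟩ := reachPlus_simCfg (ph := true) (B := fun _ => false) (o := o) (b := 0)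
          (h := h) hr hp'
        rw [h₁, h₂] at hn
        exact absurd hle hn

theorem reach_answerPhaseCfg {n : ℕ} {r r' : Cfg RevSym V} {o : ℕ → Bool} {h : ℕ}
    (hs : SkipsTo n r.out r.outHead o h) (hr : Reach R r r')
    (hn : markCount r'.out r'.outHead ≤ n) :
    ∃ o' h', SkipsTo n r'.out r'.outHead o' h' ∧
      Reach (Code.instr (simProg R)) (answerPhaseCfg n r o h) (answerPhaseCfg n r' o' h') := by
  induction hr with
  | refl => exact ⟨o, h, hs, .refl⟩
  | @tail s t _ hst ih =>
    have hst' : Reach R s t := .single hst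
    obtain ⟨o₁, h₁, hs₁, hr₁⟩ := ih (by
      rw [markCount_congr fun i hi => (hst'.out_eq hi).symm]
      exact (markCount_mono _ hst'.outHead_le).trans hn)
    obtain ⟨o₂, h₂, hs₂, hr₂⟩ := reachPlus_answerPhaseCfg hs₁ hst hn
    exact ⟨o₂, h₂, hs₂, hr₁.trans hr₂.toReach⟩

/-- The configuration `d` of the simulation of `r` lies between representatives of successive
configurations of the simulated machine, or the simulation ends without representing another
configuration. -/
def IsBracketed (R : V → Instr RevSym V) (n : ℕ) (r : Cfg RevSym V) (o : ℕ → Bool) (h : ℕ)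
    (d : Cfg Bool (Code (Task × V))) : Prop :=
  ∃ r' o' h', Reach R r r' ∧ SkipsTo n r'.out r'.outHead o' h' ∧
    Reach (Code.instr (simProg R)) (answerPhaseCfg n r o h) (answerPhaseCfg n r' o' h') ∧
    ((∃ r'' o'' h'', stepOf R r' = some r'' ∧ SkipsTo n r''.out r''.outHead o'' h'' ∧
      Reach (Code.instr (simProg R)) (answerPhaseCfg n r o h) (answerPhaseCfg n r'' o'' h'') ∧
      ReachPlus (Code.instr (simProg R)) d (answerPhaseCfg n r'' o'' h'')) ∨
    ∃ e, Reach (Code.instr (simProg R)) d e ∧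
      stepOf (Code.instr (simProg R)) e = none ∧ e.outHead = h' ∧
      (Code.instr (simProg R) e.state = .accept →
        R r'.state = .accept ∧ markCount r'.out r'.outHead = n ∧ e.out = o'))

theorem isBracketed_answerPhaseCfg {n : ℕ} {r r' : Cfg RevSym V} {o o' : ℕ → Bool} {h h' : ℕ}
    (hr' : Reach R r r') (hs' : SkipsTo n r'.out r'.outHead o' h')
    (hm' : Reach (Code.instr (simProg R)) (answerPhaseCfg n r o h) (answerPhaseCfg n r' o' h')) :
    IsBracketed R n r o h (answerPhaseCfg n r' o' h') := by
  refine ⟨r', o', h', hr', hs', hm', ?_⟩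
  rcases answerPhaseCfg_cases (R := R) hs' with ⟨r'', o'', h'', hst, hs'', H⟩ | H
  · exact Or.inl ⟨r'', o'', h'', hst, hs'', hm'.trans H.toReach, H⟩
  · exact Or.inr H

/-- By determinism, an intermediate configuration lies on the only path to the next representative
or to the blocked end of the simulation. This turns statements about arbitrary configurations of `M`
into statements about `R`. -/
theorem isBracketed_of_reach {n : ℕ} {r : Cfg RevSym V} {o : ℕ → Bool} {h : ℕ}
    {d : Cfg Bool (Code (Task × V))} (hs : SkipsTo n r.out r.outHead o h)
    (hd : Reach (Code.instr (simProg R)) (answerPhaseCfg n r o h) d) :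
    IsBracketed R n r o h d := by
  induction hd with
  | refl => exact isBracketed_answerPhaseCfg .refl hs .refl
  | @tail d d₁ _ hdd ih =>
    obtain ⟨r', o', h', hr', hs', hm', H⟩ := ih
    rcases H with ⟨r'', o'', h'', hst, hs'', hm'', H⟩ | ⟨e, he, hstuck, H⟩
    · obtain ⟨d₂, hd₂, H⟩ := Relation.TransGen.head'_iff.1 H
      obtain rfl := Option.some.inj (hdd.symm.trans hd₂)
      rcases Relation.reflTransGen_iff_eq_or_transGen.1 H with h | H
      · rw [← h]
        exact isBracketed_answerPhaseCfg (hr'.tail hst) hs'' hm''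
      · exact ⟨r', o', h', hr', hs', hm', Or.inl ⟨r'', o'', h'', hst, hs'', hm'', H⟩⟩
    · rcases Relation.ReflTransGen.cases_head he with h | ⟨d₂, hd₂, he⟩
      · subst h
        rw [hstuck] at hdd
        cases hdd
      · obtain rfl := Option.some.inj (hdd.symm.trans hd₂)
        exact ⟨r', o', h', hr', hs', hm', Or.inr ⟨e, he, hstuck, H⟩⟩

/-- If the simulated machine yields a sequence with `n` marks, then the simulation with the
answer `n` yields the part after the last mark. -/
theorem runYields_answerPhase {z : ℕ → RevSym} {y : ℕ → Bool} {N : ℕ} {r : Cfg RevSym V}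
    (hr : RunYields R r z) (hr₀ : r.outHead = 0) (hout : ∀ i, r.out i = .bit false)
    (hN : ∀ k, N = k + 1 → z k = .mark) (hbit : ∀ i, z (N + i) = .bit (y i)) :
    RunYields (Code.instr (simProg R)) (answerPhaseCfg (markCount z N) r (fun _ => false) 0) y := by
  have hs₀ : SkipsTo (markCount z N) r.out r.outHead (fun _ => false) 0 := by
    rw [hr₀]
    exact skipsTo_zero _ _
  have hcount : ∀ i, markCount z (N + i) = markCount z N := by
    intro i
    induction i with
    | zero => rfl
    | succ i ih => rw [← add_assoc, markCount_succ, hbit, ih]; rfl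
  have hstart : IsStart z (markCount z N) N := ⟨rfl, hN⟩
  have key : ∀ d, Reach R r d → N ≤ d.outHead → (∀ i < d.outHead, d.out i = z i) →
      markCount d.out d.outHead = markCount z N ∧ ∃ o, (∀ i, d.outHead - N ≤ i → o i = false) ∧
        (∀ i < d.outHead - N, o i = y i) ∧
        Reach (Code.instr (simProg R)) (answerPhaseCfg (markCount z N) r (fun _ => false) 0)
          (answerPhaseCfg (markCount z N) d o (d.outHead - N)) := by
    intro d hd hNd hz
    have hc : markCount d.out d.outHead = markCount z N := by
      rw [markCount_congr hz, ← hcount (d.outHead - N), Nat.add_sub_cancel' hNd]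
    obtain ⟨o, h, ⟨hs₁, hs₂⟩, hm⟩ := reach_answerPhaseCfg hs₀ hd hc.le
    rcases hs₂ with ⟨hlt, -⟩ | ⟨-, N', hN', hst, hb⟩
    · omega
    -- The start found by the simulation is the true one, by uniqueness of the position after the
    -- `n`-th mark.
    · obtain rfl : N' = N := (hst.congr fun i hi => hz i (by omega)).unique hstart
      obtain rfl : h = d.outHead - N' := by omega
      refine ⟨hc, o, hs₁, fun i hi => ?_, hm⟩
      have := hb i hi
      rw [hz _ (by omega), hbit] at this
      exact (RevSym.bit.inj this).symm
  rcases hr.cases with ⟨d, hd, hacc, rfl⟩ | ⟨hk, -⟩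
  · have hNd : N ≤ d.outHead := by
      rcases N with _ | N
      · exact Nat.zero_le _
      -- The last mark must have been printed before `R` accepts, since blank cells are bits.
      · by_contra hlt
        have := hN N rfl
        rw [hd.out_eq_of_ge (by omega), hout] at this
        cases this
    obtain ⟨hc, o, ho, hoy, hm⟩ := key d hd hNd fun _ _ => rfl
    obtain ⟨e, he, hacc', hoe, -⟩ := reach_accept_answerPhaseCfg (o := o) (h := d.outHead - N)
      hacc hc
    refine Or.inl ⟨e, hm.trans he, hacc', ?_⟩
    rw [hoe]
    funext i
    by_cases hi : i < d.outHead - N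
    · exact hoy i hi
    · have := hbit i
      rw [hd.out_eq_of_ge (by omega), hout] at this
      rw [ho i (by omega), RevSym.bit.inj this]
  · refine runYields_of_unbounded fun k => ?_
    obtain ⟨d, hd, hkd⟩ := hk (N + k)
    obtain ⟨hc, o, ho, hoy, hm⟩ := key d hd (by omega) fun i hi => hr.out_eq hr₀ hd hi
    refine ⟨_, hm, ?_, hoy⟩
    show k ≤ d.outHead - N
    omega

/-- Whatever the simulation yields, with whatever answer, is the part after the last mark of the
output of the simulated machine. -/
theorem exists_runYields_of_answerPhase {n : ℕ} {y : ℕ → Bool} {r : Cfg RevSym V}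
    (hr₀ : r.outHead = 0) (hout : ∀ i, r.out i = .bit false)
    (hy : RunYields (Code.instr (simProg R)) (answerPhaseCfg n r (fun _ => false) 0) y) :
    ∃ z, RunYields R r z ∧ RevisesTo z y := by
  have hs₀ : SkipsTo n r.out r.outHead (fun _ => false) 0 := by
    rw [hr₀]
    exact skipsTo_zero _ _
  rcases hy.cases with ⟨d, hd, hacc, rfl⟩ | ⟨hk, -⟩
  · obtain ⟨r', o, h, hr', ⟨hs₁, hs₂⟩, -, H⟩ := isBracketed_of_reach hs₀ hd
    -- An accepting configuration cannot move on to a next representative, so the simulation has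
    -- ended there.
    rcases H with ⟨r'', o'', h'', -, -, -, H⟩ | ⟨e, he, -, -, H⟩
    · obtain ⟨d₂, hd₂, -⟩ := Relation.TransGen.head'_iff.1 H
      rw [stepOf_accept hacc] at hd₂
      cases hd₂
    · obtain rfl := he.eq_of_stuck (stepOf_accept hacc)
      obtain ⟨hacc', hc, rfl⟩ := H hacc
      refine ⟨r'.out, Or.inl ⟨r', hr', hacc', rfl⟩, ?_⟩
      rcases hs₂ with ⟨hlt, -⟩ | ⟨-, N, hN, hst, hb⟩
      · omega
      · refine ⟨N, hst.2, fun i => ?_⟩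
        by_cases hi : i < h
        · exact hb i hi
        · rw [hr'.out_eq_of_ge (by omega), hout, hs₁ i (by omega)]
  -- In the infinite case `R` is followed until more than `j` bits after the `n`-th mark are
  -- printed. This also shows that the output of `R` is unbounded.
  · have key : ∀ j, ∃ r' N h, Reach R r r' ∧ j < h ∧ N + h = r'.outHead ∧ IsStart r'.out n N ∧
        ∀ i < h, r'.out (N + i) = .bit (y i) := by
      intro j
      obtain ⟨d, hd, hjd⟩ := hk (j + 1)
      have fin : ∀ {r' o h}, Reach R r r' → SkipsTo n r'.out r'.outHead o h →
          Reach (Code.instr (simProg R)) (answerPhaseCfg n r (fun _ => false) 0)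
            (answerPhaseCfg n r' o h) → j < h →
          ∃ r' N h, Reach R r r' ∧ j < h ∧ N + h = r'.outHead ∧ IsStart r'.out n N ∧
            ∀ i < h, r'.out (N + i) = .bit (y i) := by
        rintro r' o h hr' ⟨-, hs₂⟩ hm hj
        rcases hs₂ with ⟨-, rfl⟩ | ⟨-, N, hN, hst, hb⟩
        · omega
        · refine ⟨r', N, h, hr', hj, hN, hst, fun i hi => ?_⟩
          rw [hb i hi, ← hy.out_eq rfl hm hi]
          rfl
      obtain ⟨r', o, h, hr', hs', hm', H⟩ := isBracketed_of_reach hs₀ hd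
      rcases H with ⟨r'', o'', h'', hst, hs'', hm'', H⟩ | ⟨e, he, -, hh, -⟩
      · have : d.outHead ≤ h'' := H.toReach.outHead_le
        exact fin (hr'.tail hst) hs'' hm'' (by omega)
      · have := he.outHead_le
        exact fin hr' hs' hm' (by omega)
    choose t N h ht hj hN hst hb using key
    have hagree : ∀ j j' i, i < (t j).outHead → i < (t j').outHead →
        (t j).out i = (t j').out i := by
      intro j j' i hi hi'
      rcases (ht j).total (ht j') with H | H
      · exact (H.out_eq hi).symm
      · exact H.out_eq hi'
    have hlt : ∀ i, i < (t i).outHead := fun i => by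
      have := hN i
      have := hj i
      omega
    have hz : ∀ j, ∀ i < (t j).outHead, (t j).out i = (t i).out i := fun j i hi =>
      hagree j i i hi (hlt i)
    have hst' : ∀ j, IsStart (fun i => (t i).out i) n (N j) := fun j =>
      (hst j).congr fun i hi => hz j i (by have := hN j; omega)
    -- The output of `R` is read off diagonally: `t i` has printed more than `i` symbols, and all `t
    -- j` lie on one run.
    refine ⟨fun i => (t i).out i, runYields_of_unbounded fun k => ⟨t k, ht k, (hlt k).le, hz k⟩,
      N 0, (hst' 0).2, fun i => ?_⟩
    have hNi : N 0 = N i := (hst' 0).unique (hst' i)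
    have := hb i i (hj i)
    rw [hz i _ (by have := hN i; have := hj i; omega)] at this
    rw [hNi]
    exact this

end Answer

/-! ### Combining the two runs -/

theorem Machine.init_eq_conf (R : Machine RevSym) (x : ℕ → Bool) :
    R.init x = conf R.source x 0 (fun _ => false) 0 (fun _ => false) 0 (fun _ => .bit false) 0 := by
  unfold Machine.init conf
  congr 1 <;>
  · funext t
    rcases t with _ | i
    · rfl
    · fin_cases i <;> rfl

theorem Machine.mem_result_zero (R : Machine RevSym) (x : ℕ → Bool) (z : ℕ → RevSym) :
    z ∈ R.result (fun _ => ∅) 0 x ↔ RunYields R.instr (R.init x) z := by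
  show R.Yields (Relation.ReflTransGen (R.Step (fun _ => ∅) 0)) _ _ ↔ _
  have : R.Step (fun _ => ∅) 0 = fun c d => stepOf R.instr c = some d := by
    funext c d
    exact propext (R.step_zero _ c d)
  rw [this]
  rfl

theorem FinitelyRevisingComputable.singleQueryComputable {F : (ℕ → Bool) → Set (ℕ → Bool)}
    (hF : FinitelyRevisingComputable F) : SingleQueryComputable maxOracle F := by
  obtain ⟨R, -, hR⟩ := hF
  have : Finite R.V := R.finite
  refine ⟨Code.singleQueryMachine (simProg R.instr) (.setup true, R.source)
    (.setup false, R.source), Code.atMostOneQuery _ _ _, fun n hn x => ?_⟩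
  obtain ⟨n, rfl⟩ := Nat.exists_eq_add_of_le' hn
  -- Any `z` will do: before anything is printed, `queryPhaseCfg z` does not depend on it.
  have hquery : ∀ (z : ℕ → RevSym) (p : ℕ → Bool), RunYields (Code.instr (simProg R.instr))
      (conf (simProg R.instr (.setup false, R.source)) x 0 (fun _ => false) 0 (fun _ => false) 0
        (fun _ => false) 0) p ↔
      RunYields (Code.instr (simProg R.instr)) (queryPhaseCfg z (R.init x)) p := by
    intro z p
    have hc : counterTape 0 = fun _ => false := by
      funext i
      rw [counterTape, decide_eq_false (by omega)]
    have : queryPhaseCfg z (R.init x) =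
        simCfg false (R.init x) (fun _ => false) 0 (fun _ => false) 0 := by
      show simCfg false _ (counterTape 0) 0 _ _ = _
      rw [hc]
      rfl
    rw [this, Machine.init_eq_conf]
    exact reach_setup.runYields_iff rfl rfl p
  have hanswer : ∀ (m : ℕ) (y : ℕ → Bool), RunYields (Code.instr (simProg R.instr))
      (conf (simProg R.instr (.setup true, R.source)) x 0 (fun _ => false) 0
        (fun i => decide (i < m)) 0 (fun _ => false) 0) y ↔
      RunYields (Code.instr (simProg R.instr))
        (answerPhaseCfg m (R.init x) (fun _ => false) 0) y := by
    intro m y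
    have : (answerPhaseCfg m (R.init x) (fun _ => false) 0) =
        simCfg true (R.init x) (fun i => decide (i < m)) 0 (fun _ => false) 0 := rfl
    rw [this, Machine.init_eq_conf]
    exact reach_setup.runYields_iff rfl rfl y
  ext y
  rw [Code.mem_result _ _ _ subsingleton_maxOracle, hR, Set.mem_ofPred_eq]
  simp only [Machine.mem_result_zero]
  constructor
  -- Only the unary form of the answer matters here, not that it is the correct maximum.
  · rintro ⟨p, v, -, ⟨w, m, -, -, rfl⟩, hy⟩
    exact exists_runYields_of_answerPhase rfl (fun _ => rfl) ((hanswer m y).1 hy)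
  · rintro ⟨z, hz, N, hN, hbit⟩
    refine ⟨_, _, (hquery z _).2 (runYields_queryPhase hz rfl fun _ => rfl),
      mem_maxOracle hN fun i => ?_, (hanswer _ y).2
        (runYields_answerPhase hz rfl (fun _ => rfl) hN hbit)⟩
    rw [hbit]
    rfl

end TypeTwo

theorem theorem28 (F : (ℕ → Bool) → Set (ℕ → Bool))
    (hF : TypeTwo.FinitelyRevisingComputable F) :
    TypeTwo.SingleQueryComputable TypeTwo.maxOracle F := by
  exact hF.singleQueryComputable
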